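/- **Theorem.** Let $K$ be a field. The $2$-category of 2-term $3$-$Lie_\infty$-algebras over $K$ and the $2$-category of $3$-Lie $2$-algebras over $K$, both defined below, are $2$-equivalent: there are strict $2$-functors in both directions whose two composites are $2$-naturally isomorphic to the respective identity $2$-functors. Here "(completely) skew-symmetric" means that exchanging two of the arguments in question changes the sign. **2-term $3$-$Lie_\infty$-algebras.** Such an algebra consists of a complex of vector spaces $V_1\xrightarrow{\mathrm d}V_0$, completely skew-symmetric trilinear maps $l_3:V_i\times V_j\times V_k\to V_{i+j+k}$ for $0\le i+j+k\le 1$ (with $l_3(f,g,x)=0$ and $l_3(f,g,h)=0$ for $f,g,h\in V_1$, $x\in V_0$), and a multilinear map $l_5:(V_0\wedge V_0)\otimes(V_0\wedge V_0\wedge V_0)\to V_1$ (i.e. skew-symmetric in the first two and in the last three arguments), such that for all $x,y,x_i\in V_0$, $f,g\in V_1$: - (a) $\mathrm d\, l_3(x,y,f)=l_3(x,y,\mathrm d f)$; - (b) $l_3(\mathrm d f,g,x)=l_3(f,\mathrm d g,x)$; - (c) $\mathrm d\, l_5(x_1,\dots,x_5)=-l_3(x_1,x_2,l_3(x_3,x_4,x_5))+l_3(x_3,l_3(x_1,x_2,x_4),x_5)+l_3(l_3(x_1,x_2,x_3),x_4,x_5)+l_3(x_3,x_4,l_3(x_1,x_2,x_5))$;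 - (d) $l_5(\mathrm d f,x_2,x_3,x_4,x_5)$ is given by the right-hand side of (c) with $x_1$ replaced by $f$, and $l_5(x_1,x_2,\mathrm d f,x_4,x_5)$ by the right-hand side of (c) with $x_3$ replaced by $f$; - (e) for all $x_1,\dots,x_7\in V_0$, $$\begin{aligned}&l_3(l_5(x_1,x_2,x_3,x_4,x_5),x_6,x_7)+l_3(x_5,l_5(x_1,x_2,x_3,x_4,x_6),x_7)+l_3(x_1,x_2,l_5(x_3,x_4,x_5,x_6,x_7))\\&+l_3(x_5,x_6,l_5(x_1,x_2,x_3,x_4,x_7))+l_5(x_1,x_2,l_3(x_3,x_4,x_5),x_6,x_7)+l_5(x_1,x_2,x_5,l_3(x_3,x_4,x_6),x_7)\\&+l_5(x_1,x_2,x_5,x_6,l_3(x_3,x_4,x_7))\\=\;&l_3(x_3,x_4,l_5(x_1,x_2,x_5,x_6,x_7))+l_5(l_3(x_1,x_2,x_3),x_4,x_5,x_6,x_7)+l_5(x_3,l_3(x_1,x_2,x_4),x_5,x_6,x_7)\\&+l_5(x_3,x_4,l_3(x_1,x_2,x_5),x_6,x_7)+l_5(x_3,x_4,x_5,l_3(x_1,x_2,x_6),x_7)+l_5(x_1,x_2,x_3,x_4,l_3(x_5,x_6,x_7))\\&+l_5(x_3,x_4,x_5,x_6,l_3(x_1,x_2,x_7)).\end{aligned}$$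 A homomorphism $\phi:\mathcal V\to\mathcal V'$ consists of a chain map $(\phi_0,\phi_1)$ and a completely skew-symmetric trilinear map $\phi_2:V_0\times V_0\times V_0\to V_1'$ such that $$\mathrm d'\phi_2(x_1,x_2,x_3)=\phi_0(l_3(x_1,x_2,x_3))-l_3'(\phi_0x_1,\phi_0x_2,\phi_0x_3),$$ $$\phi_2(x_1,x_2,\mathrm d h)=\phi_1(l_3(x_1,x_2,h))-l_3'(\phi_0x_1,\phi_0x_2,\phi_1h),$$ $$\begin{aligned}&l_5'(\phi_0x_1,\dots,\phi_0x_5)+l_3'(\phi_2(x_1,x_2,x_3),\phi_0x_4,\phi_0x_5)+l_3'(\phi_0x_3,\phi_2(x_1,x_2,x_4),\phi_0x_5)+l_3'(\phi_0x_3,\phi_0x_4,\phi_2(x_1,x_2,x_5))\\&+\phi_2(l_3(x_1,x_2,x_3),x_4,x_5)+\phi_2(x_3,l_3(x_1,x_2,x_4),x_5)+\phi_2(x_3,x_4,l_3(x_1,x_2,x_5))\\=\;&l_3'(\phi_0x_1,\phi_0x_2,\phi_2(x_3,x_4,x_5))+\phi_2(x_1,x_2,l_3(x_3,x_4,x_5))+\phi_1(l_5(x_1,\dots,x_5)).\end{aligned}$$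 The composite of $\varphi:\mathcal V\to\mathcal V'$ and $\psi:\mathcal V'\to\mathcal V''$ is $(\psi_0\varphi_0,\ \psi_1\varphi_1,\ \psi_2(\varphi_0\cdot,\varphi_0\cdot,\varphi_0\cdot)+\psi_1\varphi_2)$; the identity is $(\mathrm{id},\mathrm{id},0)$. A $2$-homomorphism $\tau:\varphi\Rightarrow\psi$ is a linear map $\tau:V_0\to V_1'$ with $\mathrm d'\tau=\psi_0-\varphi_0$, $\tau\mathrm d=\psi_1-\varphi_1$ and $$\begin{aligned}(\varphi_2-\psi_2)(x_1,x_2,x_3)=\;&\big(l_3'(\varphi_0x_1,\varphi_0x_2,\tau x_3)+\text{c.p.}\big)+\big(l_3'(\mathrm d'\tau x_1,\tau x_2,\varphi_0x_3)+\text{c.p.}\big)\\&-\tau(l_3(x_1,x_2,x_3))+l_3'(\mathrm d'\tau x_1,\mathrm d'\tau x_2,\tau x_3),\end{aligned}$$ where "c.p." stands for the two other cyclic permutations of $x_1,x_2,x_3$. The vertical composite of $\tau:\varphi\Rightarrow\psi$ and $\tau':\psi\Rightarrow\mu$ is $\tau'+\tau$; the horizontal composite of $\tau:\varphi\Rightarrow\psi$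 and $\tau':\varphi'\Rightarrow\psi'$ (where $\varphi',\psi':\mathcal V'\to\mathcal V''$) is $x\mapsto\tau'(\varphi_0x)+\psi'_1(\tau x)$; identities are zero. **$3$-Lie $2$-algebras.** A $2$-vector space is a category internal to vector spaces (vector spaces $L_0$ of objects and $L_1$ of morphisms, all structure maps linear). A $3$-Lie $2$-algebra is a $2$-vector space $L$ with a completely skew-symmetric trilinear functor $[\cdot,\cdot,\cdot]:L\times L\times L\to L$ and a natural isomorphism $$J_{x_1,\dots,x_5}:[x_1,x_2,[x_3,x_4,x_5]]\to[[x_1,x_2,x_3],x_4,x_5]+[x_3,[x_1,x_2,x_4],x_5]+[x_3,x_4,[x_1,x_2,x_5]],$$ multilinear on $(L_0\wedge L_0)\otimes(L_0\wedge L_0\wedge L_0)$ (i.e. $5$-linear, and skew-symmetric in the first two and in the last three arguments), such that for all $x_1,\dots,x_7\in L_0$ the following two composites, written from left to right, agree (each $1$ is the identity morphism of the sum of the remaining terms): $$\begin{aligned}&[x_1,x_2,J_{x_3,x_4,x_5,x_6,x_7}]\,\big(J_{x_1,x_2,[x_3,x_4,x_5],x_6,x_7}+J_{x_1,x_2,x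_5,[x_3,x_4,x_6],x_7}+J_{x_1,x_2,x_5,x_6,[x_3,x_4,x_7]}\big)\\&\big([x_5,x_6,J_{x_1,x_2,x_3,x_4,x_7}]+1\big)\big([x_5,J_{x_1,x_2,x_3,x_4,x_6},x_7]+[J_{x_1,x_2,x_3,x_4,x_5},x_6,x_7]+1\big)\\=\;&J_{x_1,x_2,x_3,x_4,[x_5,x_6,x_7]}\,\big([x_3,x_4,J_{x_1,x_2,x_5,x_6,x_7}]+1\big)\big(J_{[x_1,x_2,x_3],x_4,x_5,x_6,x_7}+J_{x_3,[x_1,x_2,x_4],x_5,x_6,x_7}\\&+J_{x_3,x_4,[x_1,x_2,x_5],x_6,x_7}+J_{x_3,x_4,x_5,[x_1,x_2,x_6],x_7}+J_{x_3,x_4,x_5,x_6,[x_1,x_2,x_7]}\big).\end{aligned}$$ A homomorphism $F:L\to L'$ is a linear functor $(F_0,F_1)$ with a completely skew-symmetric trilinear natural transformation $F_2(x,y,z):[F_0x,F_0y,F_0z]'\to F_0[x,y,z]$ such that, composing from left to right, $$[1,1,F_2(x_3,x_4,x_5)]'\,F_2(x_1,x_2,[x_3,x_4,x_5])\,F_1(J_{x_1,\dots,x_5})=J'_{F_0x_1,\dots,F_0x_5}\,B\,C,$$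 where $B=[F_2(x_1,x_2,x_3),1,1]'+[1,F_2(x_1,x_2,x_4),1]'+[1,1,F_2(x_1,x_2,x_5)]'$ (here $1$ stands for the identities of the objects $F_0x_i$ in the corresponding slots, as in $[1_{F_0x_3},F_2(x_1,x_2,x_4),1_{F_0x_5}]'$) and $C=F_2([x_1,x_2,x_3],x_4,x_5)+F_2(x_3,[x_1,x_2,x_4],x_5)+F_2(x_3,x_4,[x_1,x_2,x_5])$. The composite $G\circ F$ is the composite functor with $(G\circ F)_2(x,y,z)$ equal to $G_2(F_0x,F_0y,F_0z)$ followed by $G_1(F_2(x,y,z))$; the identity homomorphism is the identity functor with the identity natural transformation. A $2$-homomorphism $\theta:F\Rightarrow G$ is a linear natural transformation such that $F_2(x,y,z)$ followed by $\theta_{[x,y,z]}$ equals $[\theta_x,\theta_y,\theta_z]'$ followed by $G_2(x,y,z)$. $2$-homomorphisms are composed vertically and horizontally, and have identities, as natural transformations. -/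

import Mathlib

open CategoryTheory Bicategory

universe w u

namespace HigherLie

/-! ### Multilinearity and skew-symmetry -/

section Multilinear

variable (K : Type w) [Field K] {A B C D : Type u}
  [AddCommGroup A] [Module K A] [AddCommGroup B] [Module K B]
  [AddCommGroup C] [Module K C] [AddCommGroup D] [Module K D]

/-- `f` is linear in each of its three variables. -/
structure IsTrilinear (f : A → B → C → D) : Prop where
  lin₁ : ∀ y z, IsLinearMap K fun x => f x y z
  lin₂ : ∀ x z, IsLinearMap K fun y => f x y z
  lin₃ : ∀ x y, IsLinearMap K fun z => f x y z

/-- `f` is linear in each of its five variables. -/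
structure IsQuintilinear (f : A → A → A → A → A → D) : Prop where
  lin₁ : ∀ b c d e, IsLinearMap K fun a => f a b c d e
  lin₂ : ∀ a c d e, IsLinearMap K fun b => f a b c d e
  lin₃ : ∀ a b d e, IsLinearMap K fun c => f a b c d e
  lin₄ : ∀ a b c e, IsLinearMap K fun d => f a b c d e
  lin₅ : ∀ a b c d, IsLinearMap K fun e => f a b c d e

/-- `f` changes sign under the two adjacent transpositions of its variables, i.e. it is
completely skew-symmetric. -/
structure IsSkew₃ (f : A → A → A → D) : Prop where
  swap₁₂ : ∀ x y z, f y x z = -f x y z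
  swap₂₃ : ∀ x y z, f x z y = -f x y z

/-- `f` is skew-symmetric in its first two variables and completely skew-symmetric in its last
three variables. -/
structure IsSkew₂₃ (f : A → A → A → A → A → D) : Prop where
  swap₁₂ : ∀ a b c d e, f b a c d e = -f a b c d e
  swap₃₄ : ∀ a b c d e, f a b d c e = -f a b c d e
  swap₄₅ : ∀ a b c d e, f a b c e d = -f a b c d e

variable {K}

namespace IsTrilinear

variable {f : A → B → C → D}

theorem add₁ (h : IsTrilinear K f) (y : B) (z : C) (x x' : A) : f (x + x') y z = f x y z + f x' y z :=
  (h.lin₁ y z).map_add x x'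

theorem sub₁ (h : IsTrilinear K f) (y : B) (z : C) (x x' : A) : f (x - x') y z = f x y z - f x' y z :=
  (h.lin₁ y z).map_sub x x'

theorem zero₁ (h : IsTrilinear K f) (y : B) (z : C) : f 0 y z = 0 :=
  (h.lin₁ y z).map_zero

theorem add₂ (h : IsTrilinear K f) (x : A) (z : C) (y y' : B) : f x (y + y') z = f x y z + f x y' z :=
  (h.lin₂ x z).map_add y y'

theorem sub₂ (h : IsTrilinear K f) (x : A) (z : C) (y y' : B) : f x (y - y') z = f x y z - f x y' z :=
  (h.lin₂ x z).map_sub y y'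

theorem zero₂ (h : IsTrilinear K f) (x : A) (z : C) : f x 0 z = 0 :=
  (h.lin₂ x z).map_zero

theorem add₃ (h : IsTrilinear K f) (x : A) (y : B) (z z' : C) : f x y (z + z') = f x y z + f x y z' :=
  (h.lin₃ x y).map_add z z'

theorem sub₃ (h : IsTrilinear K f) (x : A) (y : B) (z z' : C) : f x y (z - z') = f x y z - f x y z' :=
  (h.lin₃ x y).map_sub z z'

theorem zero₃ (h : IsTrilinear K f) (x : A) (y : B) : f x y 0 = 0 :=
  (h.lin₃ x y).map_zero

end IsTrilinear

end Multilinear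

theorem IsSkew₃.cycle {A D : Type u} [AddCommGroup D] {f : A → A → A → D} (h : IsSkew₃ f)
    (x y z : A) : f y z x = f x y z := by
  rw [h.swap₂₃, h.swap₁₂, neg_neg]

/-! ### 2-term 3-Lie-infinity-algebras -/

/-- The data of a 2-term 3-Lie-infinity-algebra: a complex `V₁ → V₀`, a completely skew-symmetric
trilinear bracket `l₃ : V_i × V_j × V_k → V_{i+j+k}` with `i + j + k ≤ 1`, and a multilinear map
`l₅ : (V₀ ∧ V₀) ⊗ (V₀ ∧ V₀ ∧ V₀) → V₁`.

By skew-symmetry the components of `l₃` with one argument in `V₁` are determined by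
`l₃' x y f = l₃(x, y, f)`; see `l₃₀₁₀` and `l₃₁₀₀`. The components of `l₃` with two or three
arguments in `V₁` are zero, so they are not recorded. -/
structure TwoTermData (K : Type w) [Field K] where
  V₀ : Type u
  V₁ : Type u
  [acg₀ : AddCommGroup V₀]
  [acg₁ : AddCommGroup V₁]
  [mod₀ : Module K V₀]
  [mod₁ : Module K V₁]
  d : V₁ →ₗ[K] V₀
  l₃ : V₀ → V₀ → V₀ → V₀
  l₃_lin : IsTrilinear K l₃
  l₃_skew : IsSkew₃ l₃
  l₃' : V₀ → V₀ → V₁ → V₁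
  l₃'_lin : IsTrilinear K l₃'
  l₃'_skew : ∀ x y f, l₃' y x f = -l₃' x y f
  l₅ : V₀ → V₀ → V₀ → V₀ → V₀ → V₁
  l₅_lin : IsQuintilinear K l₅
  l₅_skew : IsSkew₂₃ l₅

namespace TwoTermData

attribute [instance] acg₀ acg₁ mod₀ mod₁

variable {K : Type w} [Field K] (V : TwoTermData.{w, u} K)

/-- The component `l₃(x, f, y)` with `f` in `V₁`. -/
def l₃₀₁₀ (x : V.V₀) (f : V.V₁) (y : V.V₀) : V.V₁ := -V.l₃' x y f

/-- The component `l₃(f, x, y)` with `f` in `V₁`. -/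
def l₃₁₀₀ (f : V.V₁) (x y : V.V₀) : V.V₁ := V.l₃' x y f

end TwoTermData

/-- A 2-term 3-Lie-infinity-algebra. -/
structure TwoTermThreeLieInfAlg (K : Type w) [Field K] extends TwoTermData.{w, u} K where
  /-- `d l₃(x, y, f) = l₃(x, y, d f)` -/
  d_l₃ : ∀ (x y : V₀) (f : V₁), d (l₃' x y f) = l₃ x y (d f)
  /-- `l₃(d f, g, x) = l₃(f, d g, x)` -/
  l₃_d : ∀ (f g : V₁) (x : V₀),
    toTwoTermData.l₃₀₁₀ (d f) g x = toTwoTermData.l₃₁₀₀ f (d g) x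
  d_l₅ : ∀ x₁ x₂ x₃ x₄ x₅ : V₀, d (l₅ x₁ x₂ x₃ x₄ x₅) =
    -l₃ x₁ x₂ (l₃ x₃ x₄ x₅) + l₃ x₃ (l₃ x₁ x₂ x₄) x₅
      + l₃ (l₃ x₁ x₂ x₃) x₄ x₅ + l₃ x₃ x₄ (l₃ x₁ x₂ x₅)
  l₅_d₁ : ∀ (f : V₁) (x₂ x₃ x₄ x₅ : V₀), l₅ (d f) x₂ x₃ x₄ x₅ =
    -toTwoTermData.l₃₁₀₀ f x₂ (l₃ x₃ x₄ x₅)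
      + toTwoTermData.l₃₀₁₀ x₃ (toTwoTermData.l₃₁₀₀ f x₂ x₄) x₅
      + toTwoTermData.l₃₁₀₀ (toTwoTermData.l₃₁₀₀ f x₂ x₃) x₄ x₅
      + l₃' x₃ x₄ (toTwoTermData.l₃₁₀₀ f x₂ x₅)
  l₅_d₃ : ∀ (f : V₁) (x₁ x₂ x₄ x₅ : V₀), l₅ x₁ x₂ (d f) x₄ x₅ =
    -l₃' x₁ x₂ (toTwoTermData.l₃₁₀₀ f x₄ x₅)
      + toTwoTermData.l₃₁₀₀ f (l₃ x₁ x₂ x₄) x₅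
      + toTwoTermData.l₃₁₀₀ (l₃' x₁ x₂ f) x₄ x₅
      + toTwoTermData.l₃₁₀₀ f x₄ (l₃ x₁ x₂ x₅)
  coherence : ∀ x₁ x₂ x₃ x₄ x₅ x₆ x₇ : V₀,
    toTwoTermData.l₃₁₀₀ (l₅ x₁ x₂ x₃ x₄ x₅) x₆ x₇
      + toTwoTermData.l₃₀₁₀ x₅ (l₅ x₁ x₂ x₃ x₄ x₆) x₇
      + l₃' x₁ x₂ (l₅ x₃ x₄ x₅ x₆ x₇)
      + l₃' x₅ x₆ (l₅ x₁ x₂ x₃ x₄ x₇)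
      + l₅ x₁ x₂ (l₃ x₃ x₄ x₅) x₆ x₇
      + l₅ x₁ x₂ x₅ (l₃ x₃ x₄ x₆) x₇
      + l₅ x₁ x₂ x₅ x₆ (l₃ x₃ x₄ x₇)
    = l₃' x₃ x₄ (l₅ x₁ x₂ x₅ x₆ x₇)
      + l₅ (l₃ x₁ x₂ x₃) x₄ x₅ x₆ x₇
      + l₅ x₃ (l₃ x₁ x₂ x₄) x₅ x₆ x₇
      + l₅ x₃ x₄ (l₃ x₁ x₂ x₅) x₆ x₇
      + l₅ x₃ x₄ x₅ (l₃ x₁ x₂ x₆) x₇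
      + l₅ x₁ x₂ x₃ x₄ (l₃ x₅ x₆ x₇)
      + l₅ x₃ x₄ x₅ x₆ (l₃ x₁ x₂ x₇)

namespace TwoTermThreeLieInfAlg

variable {K : Type w} [Field K]

/-- A homomorphism of 2-term 3-Lie-infinity-algebras. -/
@[ext]
structure Hom (V W : TwoTermThreeLieInfAlg.{w, u} K) where
  φ₀ : V.V₀ →ₗ[K] W.V₀
  φ₁ : V.V₁ →ₗ[K] W.V₁
  φ₂ : V.V₀ → V.V₀ → V.V₀ → W.V₁
  chain : ∀ f, W.d (φ₁ f) = φ₀ (V.d f)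
  φ₂_lin : IsTrilinear K φ₂
  φ₂_skew : IsSkew₃ φ₂
  d_φ₂ : ∀ x₁ x₂ x₃, W.d (φ₂ x₁ x₂ x₃) =
    φ₀ (V.l₃ x₁ x₂ x₃) - W.l₃ (φ₀ x₁) (φ₀ x₂) (φ₀ x₃)
  φ₂_d : ∀ x₁ x₂ h, φ₂ x₁ x₂ (V.d h) =
    φ₁ (V.l₃' x₁ x₂ h) - W.l₃' (φ₀ x₁) (φ₀ x₂) (φ₁ h)
  coherence : ∀ x₁ x₂ x₃ x₄ x₅,
    W.l₅ (φ₀ x₁) (φ₀ x₂) (φ₀ x₃) (φ₀ x₄) (φ₀ x₅)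
      + W.l₃₁₀₀ (φ₂ x₁ x₂ x₃) (φ₀ x₄) (φ₀ x₅)
      + W.l₃₀₁₀ (φ₀ x₃) (φ₂ x₁ x₂ x₄) (φ₀ x₅)
      + W.l₃' (φ₀ x₃) (φ₀ x₄) (φ₂ x₁ x₂ x₅)
      + φ₂ (V.l₃ x₁ x₂ x₃) x₄ x₅ + φ₂ x₃ (V.l₃ x₁ x₂ x₄) x₅ + φ₂ x₃ x₄ (V.l₃ x₁ x₂ x₅)
    = W.l₃' (φ₀ x₁) (φ₀ x₂) (φ₂ x₃ x₄ x₅) + φ₂ x₁ x₂ (V.l₃ x₃ x₄ x₅)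
      + φ₁ (V.l₅ x₁ x₂ x₃ x₄ x₅)

/-- A 2-homomorphism `φ ⇒ ψ`: a chain homotopy `τ` from `φ` to `ψ`, compatible with `φ₂`
and `ψ₂`. -/
@[ext]
structure TwoHom {V W : TwoTermThreeLieInfAlg.{w, u} K} (φ ψ : Hom V W) where
  τ : V.V₀ →ₗ[K] W.V₁
  d_τ : ∀ x, W.d (τ x) = ψ.φ₀ x - φ.φ₀ x
  τ_d : ∀ f, τ (V.d f) = ψ.φ₁ f - φ.φ₁ f
  coherence : ∀ x₁ x₂ x₃, φ.φ₂ x₁ x₂ x₃ - ψ.φ₂ x₁ x₂ x₃ =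
    (W.l₃' (φ.φ₀ x₁) (φ.φ₀ x₂) (τ x₃) + W.l₃' (φ.φ₀ x₂) (φ.φ₀ x₃) (τ x₁)
      + W.l₃' (φ.φ₀ x₃) (φ.φ₀ x₁) (τ x₂))
    + (W.l₃₀₁₀ (W.d (τ x₁)) (τ x₂) (φ.φ₀ x₃) + W.l₃₀₁₀ (W.d (τ x₂)) (τ x₃) (φ.φ₀ x₁)
      + W.l₃₀₁₀ (W.d (τ x₃)) (τ x₁) (φ.φ₀ x₂))
    - τ (V.l₃ x₁ x₂ x₃) + W.l₃' (W.d (τ x₁)) (W.d (τ x₂)) (τ x₃)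

variable {V W X : TwoTermThreeLieInfAlg.{w, u} K}

/-- The identity homomorphism. -/
def Hom.id (V : TwoTermThreeLieInfAlg.{w, u} K) : Hom V V where
  φ₀ := LinearMap.id
  φ₁ := LinearMap.id
  φ₂ _ _ _ := 0
  chain _ := rfl
  φ₂_lin := by constructor <;> intros <;> constructor <;> simp
  φ₂_skew := by constructor <;> simp
  d_φ₂ := by simp
  φ₂_d := by simp
  coherence x₁ x₂ x₃ x₄ x₅ := by
    simp [V.l₃'_lin.zero₃, TwoTermData.l₃₁₀₀, TwoTermData.l₃₀₁₀]

theorem comp_coherence (φ : Hom V W) (ψ : Hom W X) (x₁ x₂ x₃ x₄ x₅ : V.V₀) :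
    let χ := fun x y z => ψ.φ₂ (φ.φ₀ x) (φ.φ₀ y) (φ.φ₀ z) + ψ.φ₁ (φ.φ₂ x y z)
    let χ₀ := ψ.φ₀ ∘ₗ φ.φ₀
    X.l₅ (χ₀ x₁) (χ₀ x₂) (χ₀ x₃) (χ₀ x₄) (χ₀ x₅)
      + X.l₃₁₀₀ (χ x₁ x₂ x₃) (χ₀ x₄) (χ₀ x₅)
      + X.l₃₀₁₀ (χ₀ x₃) (χ x₁ x₂ x₄) (χ₀ x₅)
      + X.l₃' (χ₀ x₃) (χ₀ x₄) (χ x₁ x₂ x₅)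
      + χ (V.l₃ x₁ x₂ x₃) x₄ x₅ + χ x₃ (V.l₃ x₁ x₂ x₄) x₅ + χ x₃ x₄ (V.l₃ x₁ x₂ x₅)
    = X.l₃' (χ₀ x₁) (χ₀ x₂) (χ x₃ x₄ x₅) + χ x₁ x₂ (V.l₃ x₃ x₄ x₅)
      + (ψ.φ₁ ∘ₗ φ.φ₁) (V.l₅ x₁ x₂ x₃ x₄ x₅) := by
  intro χ χ₀
  have h1 := ψ.coherence (φ.φ₀ x₁) (φ.φ₀ x₂) (φ.φ₀ x₃) (φ.φ₀ x₄) (φ.φ₀ x₅)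
  have h2 := congrArg ψ.φ₁ (φ.coherence x₁ x₂ x₃ x₄ x₅)
  have e1 := ψ.φ₂_d (φ.φ₀ x₁) (φ.φ₀ x₂) (φ.φ₂ x₃ x₄ x₅)
  have e2 := ψ.φ₂_d (φ.φ₀ x₃) (φ.φ₀ x₄) (φ.φ₂ x₁ x₂ x₅)
  have e3 := ψ.φ₂_d (φ.φ₀ x₃) (φ.φ₀ x₅) (φ.φ₂ x₁ x₂ x₄)
  have e4 := ψ.φ₂_d (φ.φ₀ x₄) (φ.φ₀ x₅) (φ.φ₂ x₁ x₂ x₃)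
  simp only [φ.d_φ₂, ψ.φ₂_lin.sub₃] at e1 e2 e3 e4
  have s := ψ.φ₂_skew
  rw [s.swap₂₃ _ (φ.φ₀ (V.l₃ x₁ x₂ x₄)), s.swap₂₃ _ (W.l₃ _ _ _)] at e3
  rw [s.swap₂₃ _ (φ.φ₀ (V.l₃ x₁ x₂ x₃)), s.swap₁₂ (φ.φ₀ (V.l₃ x₁ x₂ x₃)),
    s.swap₂₃ _ (W.l₃ _ _ _), s.swap₁₂ (W.l₃ _ _ _)] at e4
  simp only [TwoTermData.l₃₁₀₀, TwoTermData.l₃₀₁₀, map_add, map_neg, X.l₃'_lin.add₃, χ, χ₀,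
    LinearMap.comp_apply] at h1 h2 ⊢
  linear_combination (norm := module) h1 + h2 - e1 + e2 - e3 + e4

/-- Composition of homomorphisms (first `φ`, then `ψ`). -/
def Hom.comp (φ : Hom V W) (ψ : Hom W X) : Hom V X where
  φ₀ := ψ.φ₀ ∘ₗ φ.φ₀
  φ₁ := ψ.φ₁ ∘ₗ φ.φ₁
  φ₂ x y z := ψ.φ₂ (φ.φ₀ x) (φ.φ₀ y) (φ.φ₀ z) + ψ.φ₁ (φ.φ₂ x y z)
  chain f := by simp [φ.chain, ψ.chain]
  φ₂_lin := by
    have h := φ.φ₂_lin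
    have h' := ψ.φ₂_lin
    constructor <;> intros <;> constructor <;> intros <;>
      simp [h.add₁, h.add₂, h.add₃, h'.add₁, h'.add₂, h'.add₃, (h.lin₁ _ _).map_smul,
        (h.lin₂ _ _).map_smul, (h.lin₃ _ _).map_smul, (h'.lin₁ _ _).map_smul,
        (h'.lin₂ _ _).map_smul, (h'.lin₃ _ _).map_smul] <;> abel
  φ₂_skew := by
    constructor
    · intro x y z
      rw [φ.φ₂_skew.swap₁₂ x y z, ψ.φ₂_skew.swap₁₂ (φ.φ₀ x), map_neg]; abel
    · intro x y z
      rw [φ.φ₂_skew.swap₂₃ x y z, ψ.φ₂_skew.swap₂₃ _ (φ.φ₀ y), map_neg]; abel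
  d_φ₂ := by simp [ψ.chain, φ.d_φ₂, ψ.d_φ₂]
  φ₂_d := by simp [φ.φ₂_d, ← φ.chain, ψ.φ₂_d]
  coherence x₁ x₂ x₃ x₄ x₅ := comp_coherence φ ψ x₁ x₂ x₃ x₄ x₅

namespace TwoHom

/-- The identity 2-homomorphism. -/
def id (φ : Hom V W) : TwoHom φ φ where
  τ := 0
  d_τ := by simp
  τ_d := by simp
  coherence := by simp [W.l₃'_lin.zero₃, TwoTermData.l₃₀₁₀]

/-- Vertical composition. -/
def vcomp {φ ψ μ : Hom V W} (σ : TwoHom φ ψ) (ρ : TwoHom ψ μ) : TwoHom φ μ where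
  τ := ρ.τ + σ.τ
  d_τ x := by simp [σ.d_τ, ρ.d_τ]
  τ_d f := by simp [σ.τ_d, ρ.τ_d]
  coherence x₁ x₂ x₃ := by
    have h1 := σ.coherence x₁ x₂ x₃
    have h2 := ρ.coherence x₁ x₂ x₃
    have hψ : ∀ x, ψ.φ₀ x = φ.φ₀ x + W.d (σ.τ x) := fun x => by rw [σ.d_τ]; abel
    have sk := W.l₃'_skew
    have hd := W.l₃_d
    have hl := W.l₃'_lin
    simp only [TwoTermData.l₃₁₀₀, TwoTermData.l₃₀₁₀] at hd
    simp only [TwoTermData.l₃₀₁₀, hψ, LinearMap.add_apply, map_add,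
      hl.add₁, hl.add₂, hl.add₃] at h1 h2 ⊢
    linear_combination (norm := module) h1 + h2
      + sk (W.d (σ.τ x₂)) (φ.φ₀ x₁) (ρ.τ x₃) + sk (W.d (σ.τ x₃)) (φ.φ₀ x₂) (ρ.τ x₁)
      + sk (W.d (σ.τ x₁)) (φ.φ₀ x₃) (ρ.τ x₂)
      - hd (ρ.τ x₁) (σ.τ x₂) (φ.φ₀ x₃) - hd (ρ.τ x₂) (σ.τ x₃) (φ.φ₀ x₁)
      - hd (ρ.τ x₃) (σ.τ x₁) (φ.φ₀ x₂)
      - hd (σ.τ x₃) (ρ.τ x₂) (W.d (σ.τ x₁)) - sk (W.d (ρ.τ x₂)) (W.d (σ.τ x₁)) (σ.τ x₃)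
      + hd (ρ.τ x₁) (σ.τ x₃) (W.d (σ.τ x₂)) + sk (W.d (σ.τ x₃)) (W.d (σ.τ x₂)) (ρ.τ x₁)
      - sk (W.d (ρ.τ x₂)) (W.d (σ.τ x₁)) (ρ.τ x₃) + hd (ρ.τ x₁) (ρ.τ x₃) (W.d (σ.τ x₂))
      - sk (W.d (ρ.τ x₂)) (W.d (ρ.τ x₁)) (σ.τ x₃) - hd (ρ.τ x₂) (σ.τ x₃) (W.d (ρ.τ x₁))
      - sk (W.d (σ.τ x₃)) (W.d (ρ.τ x₁)) (ρ.τ x₂)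

/-- Whiskering `σ : ψ ⇒ ψ'` with `φ` on the source side, `x ↦ σ (φ₀ x)`: the horizontal composite
of `σ` with the identity of `φ`. -/
def whiskerLeft (φ : Hom V W) {ψ ψ' : Hom W X} (σ : TwoHom ψ ψ') :
    TwoHom (φ.comp ψ) (φ.comp ψ') where
  τ := σ.τ ∘ₗ φ.φ₀
  d_τ x := by simp [Hom.comp, σ.d_τ]
  τ_d f := by simp [Hom.comp, ← φ.chain, σ.τ_d]
  coherence x₁ x₂ x₃ := by
    have h := σ.coherence (φ.φ₀ x₁) (φ.φ₀ x₂) (φ.φ₀ x₃)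
    have e := σ.τ_d (φ.φ₂ x₁ x₂ x₃)
    rw [φ.d_φ₂, map_sub] at e
    simp only [Hom.comp, LinearMap.comp_apply]
    linear_combination (norm := module) h + e

/-- Whiskering `σ : φ ⇒ φ'` with `ψ` on the target side, `x ↦ ψ₁ (σ x)`: the horizontal composite
of the identity of `ψ` with `σ`. -/
def whiskerRight {φ φ' : Hom V W} (σ : TwoHom φ φ') (ψ : Hom W X) :
    TwoHom (φ.comp ψ) (φ'.comp ψ) where
  τ := ψ.φ₁ ∘ₗ σ.τ
  d_τ x := by simp [Hom.comp, ψ.chain, σ.d_τ]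
  τ_d f := by simp [Hom.comp, σ.τ_d]
  coherence x₁ x₂ x₃ := by
    have h := congrArg ψ.φ₁ (σ.coherence x₁ x₂ x₃)
    have hφ : ∀ x, φ'.φ₀ x = φ.φ₀ x + W.d (σ.τ x) := fun x => by rw [σ.d_τ]; abel
    have hψ : ∀ x y f, ψ.φ₁ (W.l₃' x y f) =
        ψ.φ₂ x y (W.d f) + X.l₃' (ψ.φ₀ x) (ψ.φ₀ y) (ψ.φ₁ f) := fun x y f => by
      rw [ψ.φ₂_d]; abel
    have hl := ψ.φ₂_lin
    have s := ψ.φ₂_skew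
    simp only [TwoTermData.l₃₀₁₀, map_sub, map_add, map_neg, hψ] at h
    simp only [Hom.comp, LinearMap.comp_apply, TwoTermData.l₃₀₁₀, hφ, hl.add₁, hl.add₂, hl.add₃,
      ψ.chain]
    linear_combination (norm := module) h
      + s.cycle (W.d (σ.τ x₁)) (φ.φ₀ x₂) (φ.φ₀ x₃)
      - s.cycle (φ.φ₀ x₃) (φ.φ₀ x₁) (W.d (σ.τ x₂))
      - s.swap₂₃ (W.d (σ.τ x₁)) (φ.φ₀ x₃) (W.d (σ.τ x₂))
      - s.swap₁₂ (W.d (σ.τ x₂)) (φ.φ₀ x₁) (W.d (σ.τ x₃))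
      - s.swap₂₃ (W.d (σ.τ x₃)) (φ.φ₀ x₂) (W.d (σ.τ x₁))
      - s.cycle (W.d (σ.τ x₃)) (W.d (σ.τ x₁)) (φ.φ₀ x₂)

end TwoHom

instance : CategoryStruct (TwoTermThreeLieInfAlg.{w, u} K) where
  Hom V W := Hom V W
  id V := Hom.id V
  comp φ ψ := φ.comp ψ

instance : Category (V ⟶ W) where
  Hom φ ψ := TwoHom φ ψ
  id φ := TwoHom.id φ
  comp σ ρ := σ.vcomp ρ
  id_comp σ := TwoHom.ext (add_zero σ.τ)
  comp_id σ := TwoHom.ext (zero_add σ.τ)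
  assoc σ ρ π := TwoHom.ext (add_assoc π.τ ρ.τ σ.τ).symm

theorem two_hom_ext {φ ψ : V ⟶ W} {σ ρ : φ ⟶ ψ} (h : ∀ x, TwoHom.τ σ x = TwoHom.τ ρ x) :
    σ = ρ :=
  TwoHom.ext (LinearMap.ext h)

theorem eqToHom_τ {φ ψ : V ⟶ W} (h : φ = ψ) (x : V.V₀) : TwoHom.τ (eqToHom h) x = 0 := by
  subst h; rfl

theorem comp_τ {φ ψ μ : V ⟶ W} (σ : φ ⟶ ψ) (ρ : ψ ⟶ μ) (x : V.V₀) :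
    TwoHom.τ (σ ≫ ρ) x = TwoHom.τ ρ x + TwoHom.τ σ x := rfl

theorem id_τ (φ : V ⟶ W) (x : V.V₀) : TwoHom.τ (𝟙 φ) x = 0 := rfl

theorem hom_id_comp (φ : V ⟶ W) : 𝟙 V ≫ φ = φ :=
  Hom.ext rfl rfl (by funext x y z; exact (congrArg _ (map_zero φ.φ₁)).trans (add_zero _))

theorem hom_comp_id (φ : V ⟶ W) : φ ≫ 𝟙 W = φ :=
  Hom.ext rfl rfl (by funext x y z; exact zero_add _)

theorem hom_assoc {Y : TwoTermThreeLieInfAlg.{w, u} K} (φ : V ⟶ W) (ψ : W ⟶ X) (χ : X ⟶ Y) :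
    (φ ≫ ψ) ≫ χ = φ ≫ ψ ≫ χ :=
  Hom.ext rfl rfl (by
    funext x y z
    exact (congrArg _ (map_add χ.φ₁ _ _)).trans (add_assoc _ _ _).symm)

/-- The 2-category of 2-term 3-Lie-infinity-algebras. The horizontal composite of `σ : φ ⇒ φ'`
and `ρ : ψ ⇒ ψ'` is `x ↦ ρ (φ₀ x) + ψ'₁ (σ x) = ψ₁ (σ x) + ρ (φ'₀ x)`. -/
instance : Bicategory (TwoTermThreeLieInfAlg.{w, u} K) where
  homCategory V W := inferInstance
  whiskerLeft φ _ _ σ := TwoHom.whiskerLeft φ σ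
  whiskerRight σ ψ := TwoHom.whiskerRight σ ψ
  associator φ ψ χ := eqToIso (hom_assoc φ ψ χ)
  leftUnitor φ := eqToIso (hom_id_comp φ)
  rightUnitor φ := eqToIso (hom_comp_id φ)
  whiskerLeft_id _ _ := rfl
  whiskerLeft_comp _ _ _ _ _ _ := rfl
  id_whiskerLeft σ := two_hom_ext fun x => by
    simp only [eqToIso.hom, eqToIso.inv, comp_τ, eqToHom_τ, add_zero, zero_add]; rfl
  comp_whiskerLeft φ ψ _ _ σ := two_hom_ext fun x => by
    simp only [eqToIso.hom, eqToIso.inv, comp_τ, eqToHom_τ, add_zero, zero_add]; rfl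
  id_whiskerRight φ ψ := two_hom_ext fun x => map_zero ψ.φ₁
  comp_whiskerRight σ ρ ψ := two_hom_ext fun x => map_add ψ.φ₁ _ _
  whiskerRight_id σ := two_hom_ext fun x => by
    simp only [eqToIso.hom, eqToIso.inv, comp_τ, eqToHom_τ, add_zero, zero_add]; rfl
  whiskerRight_comp σ ψ χ := two_hom_ext fun x => by
    simp only [eqToIso.hom, eqToIso.inv, comp_τ, eqToHom_τ, add_zero, zero_add]; rfl
  whisker_assoc φ _ _ σ ψ := two_hom_ext fun x => by
    simp only [eqToIso.hom, eqToIso.inv, comp_τ, eqToHom_τ, add_zero, zero_add]; rfl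
  whisker_exchange {V W X φ φ' ψ ψ'} σ ρ := two_hom_ext fun x => by
    change ψ'.φ₁ (σ.τ x) + ρ.τ (φ.φ₀ x) = ρ.τ (φ'.φ₀ x) + ψ.φ₁ (σ.τ x)
    have h := ρ.τ_d (σ.τ x)
    rw [σ.d_τ, map_sub] at h
    linear_combination (norm := module) -h
  pentagon φ ψ χ ω := two_hom_ext fun x => by
    simp only [eqToIso.hom, comp_τ, eqToHom_τ, add_zero]
    refine (congrArg₂ (· + ·) (eqToHom_τ _ _) ?_).trans (add_zero 0)
    exact (congrArg ω.φ₁ (eqToHom_τ _ _)).trans (map_zero _)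
  triangle φ ψ := two_hom_ext fun x => by
    simp only [eqToIso.hom, comp_τ, eqToHom_τ, add_zero]
    exact (eqToHom_τ _ _).trans ((congrArg ψ.φ₁ (eqToHom_τ _ _)).trans (map_zero _)).symm

instance : Bicategory.Strict (TwoTermThreeLieInfAlg.{w, u} K) where
  id_comp := hom_id_comp
  comp_id := hom_comp_id
  assoc := hom_assoc
  leftUnitor_eqToIso _ := rfl
  rightUnitor_eqToIso _ := rfl
  associator_eqToIso _ _ _ := rfl

end TwoTermThreeLieInfAlg

/-! ### 2-vector spaces -/

/-- A 2-vector space: a category in the category of vector spaces, i.e. a category with a vector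
space of objects and a vector space of morphisms whose structure maps are all linear.
`comp f g` is the composite `f` followed by `g`; the last two fields say that it is linear on
the vector space of composable pairs. -/
structure TwoVect (K : Type w) [Field K] where
  C₀ : Type u
  C₁ : Type u
  [acg₀ : AddCommGroup C₀]
  [acg₁ : AddCommGroup C₁]
  [mod₀ : Module K C₀]
  [mod₁ : Module K C₁]
  src : C₁ →ₗ[K] C₀
  tgt : C₁ →ₗ[K] C₀
  one : C₀ →ₗ[K] C₁
  comp : (f g : C₁) → tgt f = src g → C₁
  src_one : ∀ x, src (one x) = x
  tgt_one : ∀ x, tgt (one x) = x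
  src_comp : ∀ f g h, src (comp f g h) = src f
  tgt_comp : ∀ f g h, tgt (comp f g h) = tgt g
  one_comp : ∀ f, comp (one (src f)) f (tgt_one _) = f
  comp_one : ∀ f, comp f (one (tgt f)) (src_one _).symm = f
  assoc : ∀ f g k (h : tgt f = src g) (h' : tgt g = src k),
    comp (comp f g h) k ((tgt_comp f g h).trans h') =
      comp f (comp g k h') (h.trans (src_comp g k h').symm)
  comp_add : ∀ f g f' g' (h : tgt f = src g) (h' : tgt f' = src g'),
    comp (f + f') (g + g') (by rw [map_add, map_add, h, h']) = comp f g h + comp f' g' h'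
  comp_smul : ∀ (a : K) f g (h : tgt f = src g),
    comp (a • f) (a • g) (by rw [map_smul, map_smul, h]) = a • comp f g h

namespace TwoVect

attribute [instance] acg₀ acg₁ mod₀ mod₁

variable {K : Type w} [Field K]

theorem comp_eq (C : TwoVect.{w, u} K) (f g : C.C₁) (h : C.tgt f = C.src g) :
    C.comp f g h = f + g - C.one (C.tgt f) := by
  have h1 : C.tgt f = C.src (C.one (C.tgt f)) := (C.src_one _).symm
  have h2 : C.tgt 0 = C.src (g - C.one (C.tgt f)) := by
    rw [map_zero, map_sub, C.src_one, h, sub_self]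
  have h3 : C.comp 0 (g - C.one (C.tgt f)) h2 = g - C.one (C.tgt f) := by
    have e := C.one_comp (g - C.one (C.tgt f))
    have z : C.one (C.src (g - C.one (C.tgt f))) = 0 := by rw [← h2, map_zero, map_zero]
    simpa only [z] using e
  have e := C.comp_add _ _ _ _ h1 h2
  rw [h3, C.comp_one] at e
  simp only [add_zero, add_sub_cancel] at e
  rw [e]; abel

/-- A morphism of a 2-vector space is invertible. -/
def IsInvertible (C : TwoVect.{w, u} K) (f : C.C₁) : Prop :=
  ∃ (g : C.C₁) (h : C.tgt f = C.src g) (h' : C.tgt g = C.src f),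
    C.comp f g h = C.one (C.src f) ∧ C.comp g f h' = C.one (C.tgt f)

/-- A linear functor between 2-vector spaces. -/
@[ext]
structure LinFunctor (C D : TwoVect.{w, u} K) where
  obj : C.C₀ →ₗ[K] D.C₀
  map : C.C₁ →ₗ[K] D.C₁
  src_map : ∀ f, D.src (map f) = obj (C.src f)
  tgt_map : ∀ f, D.tgt (map f) = obj (C.tgt f)
  map_one : ∀ x, map (C.one x) = D.one (obj x)
  map_comp : ∀ f g (h : C.tgt f = C.src g), map (C.comp f g h) =
    D.comp (map f) (map g) (by rw [tgt_map, src_map, h])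

/-- A completely skew-symmetric trilinear functor `C × C × C → C`. -/
structure TriFunctor (C : TwoVect.{w, u} K) where
  obj : C.C₀ → C.C₀ → C.C₀ → C.C₀
  map : C.C₁ → C.C₁ → C.C₁ → C.C₁
  obj_lin : IsTrilinear K obj
  map_lin : IsTrilinear K map
  obj_skew : IsSkew₃ obj
  map_skew : IsSkew₃ map
  src_map : ∀ f g h, C.src (map f g h) = obj (C.src f) (C.src g) (C.src h)
  tgt_map : ∀ f g h, C.tgt (map f g h) = obj (C.tgt f) (C.tgt g) (C.tgt h)
  map_one : ∀ x y z, map (C.one x) (C.one y) (C.one z) = C.one (obj x y z)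
  map_comp : ∀ f g h f' g' h' (hf : C.tgt f = C.src f') (hg : C.tgt g = C.src g')
    (hh : C.tgt h = C.src h'),
    map (C.comp f f' hf) (C.comp g g' hg) (C.comp h h' hh) =
      C.comp (map f g h) (map f' g' h') (by rw [tgt_map, src_map, hf, hg, hh])

namespace TriFunctor

variable {C : TwoVect.{w, u} K} (b : C.TriFunctor) (f₁ f₂ f₃ f₄ f₅ : C.C₁)

theorem tgt_nested : C.tgt (b.map f₁ f₂ (b.map f₃ f₄ f₅)) =
    b.obj (C.tgt f₁) (C.tgt f₂) (b.obj (C.tgt f₃) (C.tgt f₄) (C.tgt f₅)) := by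
  simp only [b.tgt_map]

theorem src_nested : C.src (b.map (b.map f₁ f₂ f₃) f₄ f₅ + b.map f₃ (b.map f₁ f₂ f₄) f₅
      + b.map f₃ f₄ (b.map f₁ f₂ f₅)) =
    b.obj (b.obj (C.src f₁) (C.src f₂) (C.src f₃)) (C.src f₄) (C.src f₅)
      + b.obj (C.src f₃) (b.obj (C.src f₁) (C.src f₂) (C.src f₄)) (C.src f₅)
      + b.obj (C.src f₃) (C.src f₄) (b.obj (C.src f₁) (C.src f₂) (C.src f₅)) := by
  simp only [map_add, b.src_map]

end TriFunctor

end TwoVect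

/-! ### 3-Lie 2-algebras -/

/-- The data of a 3-Lie 2-algebra: a 2-vector space `L`, a completely skew-symmetric trilinear
functor `br = [·,·,·]`, and a natural isomorphism
`J : [x₁,x₂,[x₃,x₄,x₅]] → [[x₁,x₂,x₃],x₄,x₅] + [x₃,[x₁,x₂,x₄],x₅] + [x₃,x₄,[x₁,x₂,x₅]]` that is
multilinear on `(L₀ ∧ L₀) ⊗ (L₀ ∧ L₀ ∧ L₀)`. -/
structure ThreeLieTwoData (K : Type w) [Field K] extends TwoVect.{w, u} K where
  br : toTwoVect.TriFunctor
  J : C₀ → C₀ → C₀ → C₀ → C₀ → C₁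
  J_lin : IsQuintilinear K J
  J_skew : IsSkew₂₃ J
  src_J : ∀ x₁ x₂ x₃ x₄ x₅, src (J x₁ x₂ x₃ x₄ x₅) = br.obj x₁ x₂ (br.obj x₃ x₄ x₅)
  tgt_J : ∀ x₁ x₂ x₃ x₄ x₅, tgt (J x₁ x₂ x₃ x₄ x₅) =
    br.obj (br.obj x₁ x₂ x₃) x₄ x₅ + br.obj x₃ (br.obj x₁ x₂ x₄) x₅
      + br.obj x₃ x₄ (br.obj x₁ x₂ x₅)
  J_nat : ∀ f₁ f₂ f₃ f₄ f₅ : C₁,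
    comp (br.map f₁ f₂ (br.map f₃ f₄ f₅)) (J (tgt f₁) (tgt f₂) (tgt f₃) (tgt f₄) (tgt f₅))
        ((br.tgt_nested f₁ f₂ f₃ f₄ f₅).trans (src_J _ _ _ _ _).symm) =
      comp (J (src f₁) (src f₂) (src f₃) (src f₄) (src f₅))
        (br.map (br.map f₁ f₂ f₃) f₄ f₅ + br.map f₃ (br.map f₁ f₂ f₄) f₅
          + br.map f₃ f₄ (br.map f₁ f₂ f₅))
        ((tgt_J _ _ _ _ _).trans (br.src_nested f₁ f₂ f₃ f₄ f₅).symm)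
  J_iso : ∀ x₁ x₂ x₃ x₄ x₅, toTwoVect.IsInvertible (J x₁ x₂ x₃ x₄ x₅)

namespace ThreeLieTwoData

variable {K : Type w} [Field K] (L : ThreeLieTwoData.{w, u} K)

section Fundamentor

variable (x₁ x₂ x₃ x₄ x₅ x₆ x₇ : L.C₀)

/-- `[x₁, x₂, J_{x₃,x₄,x₅,x₆,x₇}]`. -/
def fundA : L.C₁ := L.br.map (L.one x₁) (L.one x₂) (L.J x₃ x₄ x₅ x₆ x₇)

/-- `J_{x₁,x₂,[x₃,x₄,x₅],x₆,x₇} + J_{x₁,x₂,x₅,[x₃,x₄,x₆],x₇} + J_{x₁,x₂,x₅,x₆,[x₃,x₄,x₇]}`. -/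
def fundP : L.C₁ :=
  L.J x₁ x₂ (L.br.obj x₃ x₄ x₅) x₆ x₇ + L.J x₁ x₂ x₅ (L.br.obj x₃ x₄ x₆) x₇
    + L.J x₁ x₂ x₅ x₆ (L.br.obj x₃ x₄ x₇)

/-- `[x₅, x₆, J_{x₁,x₂,x₃,x₄,x₇}] + 1`. -/
def fundT : L.C₁ :=
  L.br.map (L.one x₅) (L.one x₆) (L.J x₁ x₂ x₃ x₄ x₇)
    + L.one (L.br.obj (L.br.obj x₁ x₂ (L.br.obj x₃ x₄ x₅)) x₆ x₇
      + L.br.obj (L.br.obj x₃ x₄ x₅) (L.br.obj x₁ x₂ x₆) x₇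
      + L.br.obj (L.br.obj x₃ x₄ x₅) x₆ (L.br.obj x₁ x₂ x₇)
      + L.br.obj (L.br.obj x₁ x₂ x₅) (L.br.obj x₃ x₄ x₆) x₇
      + L.br.obj x₅ (L.br.obj x₁ x₂ (L.br.obj x₃ x₄ x₆)) x₇
      + L.br.obj x₅ (L.br.obj x₃ x₄ x₆) (L.br.obj x₁ x₂ x₇)
      + L.br.obj (L.br.obj x₁ x₂ x₅) x₆ (L.br.obj x₃ x₄ x₇)
      + L.br.obj x₅ (L.br.obj x₁ x₂ x₆) (L.br.obj x₃ x₄ x₇))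

/-- `[x₅, J_{x₁,x₂,x₃,x₄,x₆}, x₇] + [J_{x₁,x₂,x₃,x₄,x₅}, x₆, x₇] + 1`. -/
def fundQ : L.C₁ :=
  L.br.map (L.one x₅) (L.J x₁ x₂ x₃ x₄ x₆) (L.one x₇)
    + L.br.map (L.J x₁ x₂ x₃ x₄ x₅) (L.one x₆) (L.one x₇)
    + L.one (L.br.obj (L.br.obj x₃ x₄ x₅) (L.br.obj x₁ x₂ x₆) x₇
      + L.br.obj (L.br.obj x₃ x₄ x₅) x₆ (L.br.obj x₁ x₂ x₇)
      + L.br.obj (L.br.obj x₁ x₂ x₅) (L.br.obj x₃ x₄ x₆) x₇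
      + L.br.obj x₅ (L.br.obj x₃ x₄ x₆) (L.br.obj x₁ x₂ x₇)
      + L.br.obj (L.br.obj x₁ x₂ x₅) x₆ (L.br.obj x₃ x₄ x₇)
      + L.br.obj x₅ (L.br.obj x₁ x₂ x₆) (L.br.obj x₃ x₄ x₇)
      + L.br.obj x₅ x₆ (L.br.obj (L.br.obj x₁ x₂ x₃) x₄ x₇)
      + L.br.obj x₅ x₆ (L.br.obj x₃ (L.br.obj x₁ x₂ x₄) x₇)
      + L.br.obj x₅ x₆ (L.br.obj x₃ x₄ (L.br.obj x₁ x₂ x₇)))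

/-- `J_{x₁,x₂,x₃,x₄,[x₅,x₆,x₇]}`. -/
def fundB : L.C₁ := L.J x₁ x₂ x₃ x₄ (L.br.obj x₅ x₆ x₇)

/-- `[x₃, x₄, J_{x₁,x₂,x₅,x₆,x₇}] + 1`. -/
def fundS : L.C₁ :=
  L.br.map (L.one x₃) (L.one x₄) (L.J x₁ x₂ x₅ x₆ x₇)
    + L.one (L.br.obj (L.br.obj x₁ x₂ x₃) x₄ (L.br.obj x₅ x₆ x₇)
      + L.br.obj x₃ (L.br.obj x₁ x₂ x₄) (L.br.obj x₅ x₆ x₇))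

/-- `J_{[x₁,x₂,x₃],x₄,x₅,x₆,x₇} + J_{x₃,[x₁,x₂,x₄],x₅,x₆,x₇} + J_{x₃,x₄,[x₁,x₂,x₅],x₆,x₇}
+ J_{x₃,x₄,x₅,[x₁,x₂,x₆],x₇} + J_{x₃,x₄,x₅,x₆,[x₁,x₂,x₇]}`. -/
def fundR : L.C₁ :=
  L.J (L.br.obj x₁ x₂ x₃) x₄ x₅ x₆ x₇ + L.J x₃ (L.br.obj x₁ x₂ x₄) x₅ x₆ x₇
    + L.J x₃ x₄ (L.br.obj x₁ x₂ x₅) x₆ x₇ + L.J x₃ x₄ x₅ (L.br.obj x₁ x₂ x₆) x₇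
    + L.J x₃ x₄ x₅ x₆ (L.br.obj x₁ x₂ x₇)

theorem tgt_fundA : L.tgt (L.fundA x₁ x₂ x₃ x₄ x₅ x₆ x₇) =
    L.src (L.fundP x₁ x₂ x₃ x₄ x₅ x₆ x₇) := by
  have h := L.br.obj_lin
  simp only [fundA, fundP, map_add, L.br.tgt_map, L.tgt_one, L.src_J, L.tgt_J, h.add₃]

theorem tgt_fundP : L.tgt (L.fundP x₁ x₂ x₃ x₄ x₅ x₆ x₇) =
    L.src (L.fundT x₁ x₂ x₃ x₄ x₅ x₆ x₇) := by
  simp only [fundP, fundT, map_add, L.br.src_map, L.src_one, L.src_J, L.tgt_J]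
  abel

theorem tgt_fundT : L.tgt (L.fundT x₁ x₂ x₃ x₄ x₅ x₆ x₇) =
    L.src (L.fundQ x₁ x₂ x₃ x₄ x₅ x₆ x₇) := by
  have h := L.br.obj_lin
  simp only [fundT, fundQ, map_add, L.br.tgt_map, L.br.src_map, L.tgt_one, L.src_one, L.src_J,
    L.tgt_J, h.add₃]
  abel

theorem tgt_fundB : L.tgt (L.fundB x₁ x₂ x₃ x₄ x₅ x₆ x₇) =
    L.src (L.fundS x₁ x₂ x₃ x₄ x₅ x₆ x₇) := by
  simp only [fundB, fundS, map_add, L.br.src_map, L.src_one, L.src_J, L.tgt_J]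
  abel

theorem tgt_fundS : L.tgt (L.fundS x₁ x₂ x₃ x₄ x₅ x₆ x₇) =
    L.src (L.fundR x₁ x₂ x₃ x₄ x₅ x₆ x₇) := by
  have h := L.br.obj_lin
  simp only [fundS, fundR, map_add, L.br.tgt_map, L.tgt_one, L.src_J, L.tgt_J, h.add₃]
  abel

end Fundamentor

end ThreeLieTwoData

/-- A 3-Lie 2-algebra: the composites `A ≫ P ≫ T ≫ Q` and `B ≫ S ≫ R` agree. -/
structure ThreeLieTwoAlg (K : Type w) [Field K] extends ThreeLieTwoData.{w, u} K where
  fundamentor : ∀ x₁ x₂ x₃ x₄ x₅ x₆ x₇ : C₀,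
    comp (toThreeLieTwoData.fundA x₁ x₂ x₃ x₄ x₅ x₆ x₇)
      (comp (toThreeLieTwoData.fundP x₁ x₂ x₃ x₄ x₅ x₆ x₇)
        (comp (toThreeLieTwoData.fundT x₁ x₂ x₃ x₄ x₅ x₆ x₇)
          (toThreeLieTwoData.fundQ x₁ x₂ x₃ x₄ x₅ x₆ x₇)
          (toThreeLieTwoData.tgt_fundT x₁ x₂ x₃ x₄ x₅ x₆ x₇))
        ((toThreeLieTwoData.tgt_fundP x₁ x₂ x₃ x₄ x₅ x₆ x₇).trans (src_comp _ _ _).symm))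
      ((toThreeLieTwoData.tgt_fundA x₁ x₂ x₃ x₄ x₅ x₆ x₇).trans (src_comp _ _ _).symm)
    = comp (toThreeLieTwoData.fundB x₁ x₂ x₃ x₄ x₅ x₆ x₇)
      (comp (toThreeLieTwoData.fundS x₁ x₂ x₃ x₄ x₅ x₆ x₇)
        (toThreeLieTwoData.fundR x₁ x₂ x₃ x₄ x₅ x₆ x₇)
        (toThreeLieTwoData.tgt_fundS x₁ x₂ x₃ x₄ x₅ x₆ x₇))
      ((toThreeLieTwoData.tgt_fundB x₁ x₂ x₃ x₄ x₅ x₆ x₇).trans (src_comp _ _ _).symm)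

namespace ThreeLieTwoAlg

variable {K : Type w} [Field K]

/-- The data of a homomorphism of 3-Lie 2-algebras: a linear functor `F` and a completely
skew-symmetric trilinear natural transformation `F₂ : [F x, F y, F z] → F [x, y, z]`. -/
structure HomData (L M : ThreeLieTwoAlg.{w, u} K) extends
    TwoVect.LinFunctor L.toTwoVect M.toTwoVect where
  F₂ : L.C₀ → L.C₀ → L.C₀ → M.C₁
  F₂_lin : IsTrilinear K F₂
  F₂_skew : IsSkew₃ F₂
  src_F₂ : ∀ x y z, M.src (F₂ x y z) = M.br.obj (obj x) (obj y) (obj z)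
  tgt_F₂ : ∀ x y z, M.tgt (F₂ x y z) = obj (L.br.obj x y z)
  F₂_nat : ∀ f g h : L.C₁,
    M.comp (M.br.map (map f) (map g) (map h)) (F₂ (L.tgt f) (L.tgt g) (L.tgt h))
        (by simp only [M.br.tgt_map, src_F₂, tgt_map]) =
      M.comp (F₂ (L.src f) (L.src g) (L.src h)) (map (L.br.map f g h))
        (by simp only [src_map, tgt_F₂, L.br.src_map])

namespace HomData

variable {L M : ThreeLieTwoAlg.{w, u} K} (F : HomData L M) (x₁ x₂ x₃ x₄ x₅ : L.C₀)

/-- `[1, 1, F₂] : [F x₁, F x₂, [F x₃, F x₄, F x₅]] → [F x₁, F x₂, F [x₃, x₄, x₅]]`. -/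
def pathA : M.C₁ := M.br.map (M.one (F.obj x₁)) (M.one (F.obj x₂)) (F.F₂ x₃ x₄ x₅)

/-- `[F₂, 1, 1] + [1, F₂, 1] + [1, 1, F₂]`. -/
def pathB : M.C₁ :=
  M.br.map (F.F₂ x₁ x₂ x₃) (M.one (F.obj x₄)) (M.one (F.obj x₅))
    + M.br.map (M.one (F.obj x₃)) (F.F₂ x₁ x₂ x₄) (M.one (F.obj x₅))
    + M.br.map (M.one (F.obj x₃)) (M.one (F.obj x₄)) (F.F₂ x₁ x₂ x₅)

/-- `F₂ + F₂ + F₂`. -/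
def pathC : M.C₁ :=
  F.F₂ (L.br.obj x₁ x₂ x₃) x₄ x₅ + F.F₂ x₃ (L.br.obj x₁ x₂ x₄) x₅
    + F.F₂ x₃ x₄ (L.br.obj x₁ x₂ x₅)

theorem tgt_pathA : M.tgt (F.pathA x₁ x₂ x₃ x₄ x₅) =
    M.src (F.F₂ x₁ x₂ (L.br.obj x₃ x₄ x₅)) := by
  simp only [pathA, M.br.tgt_map, M.tgt_one, F.tgt_F₂, F.src_F₂]

theorem tgt_F₂_J : M.tgt (F.F₂ x₁ x₂ (L.br.obj x₃ x₄ x₅)) =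
    M.src (F.map (L.J x₁ x₂ x₃ x₄ x₅)) := by
  simp only [F.tgt_F₂, F.src_map, L.src_J]

theorem tgt_J_pathB : M.tgt (M.J (F.obj x₁) (F.obj x₂) (F.obj x₃) (F.obj x₄) (F.obj x₅)) =
    M.src (F.pathB x₁ x₂ x₃ x₄ x₅) := by
  simp only [pathB, map_add, M.br.src_map, M.src_one, F.src_F₂, M.tgt_J]

theorem tgt_pathB : M.tgt (F.pathB x₁ x₂ x₃ x₄ x₅) = M.src (F.pathC x₁ x₂ x₃ x₄ x₅) := by
  simp only [pathB, pathC, map_add, M.br.tgt_map, M.tgt_one, F.src_F₂, F.tgt_F₂]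

end HomData

/-- A homomorphism of 3-Lie 2-algebras: the two composites from `[F x₁, F x₂, [F x₃, F x₄, F x₅]]`
to `F [[x₁, x₂, x₃], x₄, x₅] + F [x₃, [x₁, x₂, x₄], x₅] + F [x₃, x₄, [x₁, x₂, x₅]]` agree. -/
structure Hom (L M : ThreeLieTwoAlg.{w, u} K) extends HomData L M where
  coherence : ∀ x₁ x₂ x₃ x₄ x₅ : L.C₀,
    M.comp (toHomData.pathA x₁ x₂ x₃ x₄ x₅)
      (M.comp (F₂ x₁ x₂ (L.br.obj x₃ x₄ x₅)) (map (L.J x₁ x₂ x₃ x₄ x₅))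
        (toHomData.tgt_F₂_J x₁ x₂ x₃ x₄ x₅))
      ((toHomData.tgt_pathA x₁ x₂ x₃ x₄ x₅).trans (M.src_comp _ _ _).symm)
    = M.comp (M.J (obj x₁) (obj x₂) (obj x₃) (obj x₄) (obj x₅))
      (M.comp (toHomData.pathB x₁ x₂ x₃ x₄ x₅) (toHomData.pathC x₁ x₂ x₃ x₄ x₅)
        (toHomData.tgt_pathB x₁ x₂ x₃ x₄ x₅))
      ((toHomData.tgt_J_pathB x₁ x₂ x₃ x₄ x₅).trans (M.src_comp _ _ _).symm)

/-- A 2-homomorphism `F ⇒ G`: a linear natural transformation `θ` compatible with `F₂` and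
`G₂`. -/
@[ext]
structure TwoHom {L M : ThreeLieTwoAlg.{w, u} K} (F G : Hom L M) where
  θ : L.C₀ →ₗ[K] M.C₁
  src_θ : ∀ x, M.src (θ x) = F.obj x
  tgt_θ : ∀ x, M.tgt (θ x) = G.obj x
  nat : ∀ f, M.comp (F.map f) (θ (L.tgt f)) (by rw [F.tgt_map, src_θ]) =
    M.comp (θ (L.src f)) (G.map f) (by rw [tgt_θ, G.src_map])
  coherence : ∀ x y z,
    M.comp (F.F₂ x y z) (θ (L.br.obj x y z)) (by rw [F.tgt_F₂, src_θ]) =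
      M.comp (M.br.map (θ x) (θ y) (θ z)) (G.F₂ x y z)
        (by simp only [M.br.tgt_map, tgt_θ, G.src_F₂])

end ThreeLieTwoAlg

namespace ThreeLieTwoAlg

variable {K : Type w} [Field K] {L M N : ThreeLieTwoAlg.{w, u} K}

theorem Hom.ext' {F G : Hom L M} (h₀ : F.obj = G.obj) (h₁ : F.map = G.map) (h₂ : F.F₂ = G.F₂) :
    F = G := by
  obtain ⟨⟨⟨_, _, _, _, _, _⟩, _, _, _, _, _, _⟩, _⟩ := F
  obtain ⟨⟨⟨_, _, _, _, _, _⟩, _, _, _, _, _, _⟩, _⟩ := G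
  subst h₀ h₁ h₂
  rfl

/-- The identity functor of a 2-vector space. -/
def idFunctor (C : TwoVect.{w, u} K) : C.LinFunctor C where
  obj := LinearMap.id
  map := LinearMap.id
  src_map _ := rfl
  tgt_map _ := rfl
  map_one _ := rfl
  map_comp _ _ _ := rfl

/-- Composition of linear functors (first `F`, then `G`). -/
def compFunctor {C D E : TwoVect.{w, u} K} (F : C.LinFunctor D) (G : D.LinFunctor E) :
    C.LinFunctor E where
  obj := G.obj ∘ₗ F.obj
  map := G.map ∘ₗ F.map
  src_map f := by simp [G.src_map, F.src_map]
  tgt_map f := by simp [G.tgt_map, F.tgt_map]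
  map_one x := by simp [G.map_one, F.map_one]
  map_comp f g h := by simp [G.map_comp, F.map_comp]

/-- The identity homomorphism: the identity functor, with the identity natural transformation. -/
def Hom.id (L : ThreeLieTwoAlg.{w, u} K) : Hom L L where
  toLinFunctor := idFunctor L.toTwoVect
  F₂ x y z := L.one (L.br.obj x y z)
  F₂_lin := by
    have h := L.br.obj_lin
    constructor <;> intros <;> constructor <;> intros <;>
      simp [h.add₁, h.add₂, h.add₃, (h.lin₁ _ _).map_smul, (h.lin₂ _ _).map_smul,
        (h.lin₃ _ _).map_smul]
  F₂_skew := by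
    constructor
    · intro x y z
      rw [L.br.obj_skew.swap₁₂ x y z, map_neg]
    · intro x y z
      rw [L.br.obj_skew.swap₂₃ x y z, map_neg]
  src_F₂ _ _ _ := L.src_one _
  tgt_F₂ _ _ _ := L.tgt_one _
  F₂_nat f g h := by
    simp only [TwoVect.comp_eq, L.br.tgt_map, L.tgt_one, idFunctor, LinearMap.id_apply]
    abel
  coherence x₁ x₂ x₃ x₄ x₅ := by
    simp only [TwoVect.comp_eq, HomData.pathA, HomData.pathB, HomData.pathC, idFunctor,
      LinearMap.id_apply, L.tgt_one, L.br.map_one, map_add, L.tgt_J]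
    abel

/-- The composite natural transformation `G₁ (F₂ x y z) ∘ G₂ (F x) (F y) (F z)`. -/
def compF₂ (F : Hom L M) (G : Hom M N) (x y z : L.C₀) : N.C₁ :=
  N.comp (G.F₂ (F.obj x) (F.obj y) (F.obj z)) (G.map (F.F₂ x y z))
    (by rw [G.tgt_F₂, G.src_map, F.src_F₂])

theorem compF₂_eq (F : Hom L M) (G : Hom M N) (x y z : L.C₀) :
    compF₂ F G x y z = G.F₂ (F.obj x) (F.obj y) (F.obj z) + G.map (F.F₂ x y z)
      - N.one (G.obj (M.br.obj (F.obj x) (F.obj y) (F.obj z))) := by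
  rw [compF₂, TwoVect.comp_eq, G.tgt_F₂]

/-- The data of the composite of two homomorphisms. -/
def compData (F : Hom L M) (G : Hom M N) : HomData L N where
  toLinFunctor := compFunctor F.toLinFunctor G.toLinFunctor
  F₂ := compF₂ F G
  F₂_lin := by
    have h := F.F₂_lin
    have h' := G.F₂_lin
    have h'' := M.br.obj_lin
    constructor <;> intros <;> constructor <;> intros <;>
      simp only [compF₂_eq, map_add, map_smul, h.add₁, h.add₂, h.add₃, h'.add₁, h'.add₂, h'.add₃,
        h''.add₁, h''.add₂, h''.add₃, (h.lin₁ _ _).map_smul,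
        (h.lin₂ _ _).map_smul, (h.lin₃ _ _).map_smul, (h'.lin₁ _ _).map_smul,
        (h'.lin₂ _ _).map_smul, (h'.lin₃ _ _).map_smul, (h''.lin₁ _ _).map_smul,
        (h''.lin₂ _ _).map_smul, (h''.lin₃ _ _).map_smul] <;> module
  F₂_skew := by
    constructor
    · intro x y z
      rw [compF₂_eq, compF₂_eq, F.F₂_skew.swap₁₂ x y z, G.F₂_skew.swap₁₂ (F.obj x),
        M.br.obj_skew.swap₁₂ (F.obj x)]
      simp only [map_neg]; abel
    · intro x y z
      rw [compF₂_eq, compF₂_eq, F.F₂_skew.swap₂₃ x y z, G.F₂_skew.swap₂₃ _ (F.obj y),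
        M.br.obj_skew.swap₂₃ _ (F.obj y)]
      simp only [map_neg]; abel
  src_F₂ x y z := (N.src_comp _ _ _).trans (G.src_F₂ _ _ _)
  tgt_F₂ x y z := (N.tgt_comp _ _ _).trans ((G.tgt_map _).trans (congrArg _ (F.tgt_F₂ _ _ _)))
  F₂_nat f g h := by
    have h1 := G.F₂_nat (F.map f) (F.map g) (F.map h)
    have h2 := congrArg G.map (F.F₂_nat f g h)
    simp only [TwoVect.comp_eq, map_add, map_sub, G.map_one, N.br.tgt_map, M.br.tgt_map,
      G.tgt_F₂, F.tgt_F₂, G.tgt_map, F.tgt_map, F.src_map] at h1 h2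
    simp only [TwoVect.comp_eq, compF₂_eq, compFunctor, LinearMap.comp_apply, map_add, map_sub,
      N.br.tgt_map, G.tgt_F₂, F.tgt_F₂, G.tgt_map, F.tgt_map, N.tgt_one]
    linear_combination (norm := module) h1 + h2

theorem compData_coherence (F : Hom L M) (G : Hom M N) (x₁ x₂ x₃ x₄ x₅ : L.C₀) :
    N.comp ((compData F G).pathA x₁ x₂ x₃ x₄ x₅)
      (N.comp ((compData F G).F₂ x₁ x₂ (L.br.obj x₃ x₄ x₅))
        ((compData F G).map (L.J x₁ x₂ x₃ x₄ x₅))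
        ((compData F G).tgt_F₂_J x₁ x₂ x₃ x₄ x₅))
      (((compData F G).tgt_pathA x₁ x₂ x₃ x₄ x₅).trans (N.src_comp _ _ _).symm)
    = N.comp (N.J ((compData F G).obj x₁) ((compData F G).obj x₂) ((compData F G).obj x₃)
        ((compData F G).obj x₄) ((compData F G).obj x₅))
      (N.comp ((compData F G).pathB x₁ x₂ x₃ x₄ x₅) ((compData F G).pathC x₁ x₂ x₃ x₄ x₅)
        ((compData F G).tgt_pathB x₁ x₂ x₃ x₄ x₅))
      (((compData F G).tgt_J_pathB x₁ x₂ x₃ x₄ x₅).trans (N.src_comp _ _ _).symm) := by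
  have h1 := G.coherence (F.obj x₁) (F.obj x₂) (F.obj x₃) (F.obj x₄) (F.obj x₅)
  have h2 := congrArg G.map (F.coherence x₁ x₂ x₃ x₄ x₅)
  have n1 := G.F₂_nat (M.one (F.obj x₁)) (M.one (F.obj x₂)) (F.F₂ x₃ x₄ x₅)
  have n2 := G.F₂_nat (F.F₂ x₁ x₂ x₃) (M.one (F.obj x₄)) (M.one (F.obj x₅))
  have n3 := G.F₂_nat (M.one (F.obj x₃)) (F.F₂ x₁ x₂ x₄) (M.one (F.obj x₅))
  have n4 := G.F₂_nat (M.one (F.obj x₃)) (M.one (F.obj x₄)) (F.F₂ x₁ x₂ x₅)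
  have a := N.br.map_lin
  simp only [TwoVect.comp_eq, HomData.pathA, HomData.pathB, HomData.pathC, map_add, map_sub,
    G.map_one, N.br.tgt_map, M.br.tgt_map, N.tgt_one, M.tgt_one, M.src_one, G.tgt_F₂, F.tgt_F₂,
    G.tgt_map, F.src_F₂, M.tgt_J, N.tgt_J] at h1 h2 n1 n2 n3 n4
  simp only [TwoVect.comp_eq, HomData.pathA, HomData.pathB, HomData.pathC, compData, compF₂_eq,
    compFunctor, LinearMap.comp_apply, map_add, map_sub, a.add₁, a.add₂, a.add₃, a.sub₁, a.sub₂,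
    a.sub₃, N.br.map_one, G.tgt_map,
    N.br.tgt_map, N.tgt_one, G.tgt_F₂, F.tgt_F₂, N.tgt_J]
  linear_combination (norm := module) h1 + h2 + n1 - n2 - n3 - n4

/-- Composition of homomorphisms (first `F`, then `G`). -/
def Hom.comp (F : Hom L M) (G : Hom M N) : Hom L N where
  toHomData := compData F G
  coherence := compData_coherence F G

namespace TwoHom

/-- The identity 2-homomorphism, i.e. the identity natural transformation. -/
def id (F : Hom L M) : TwoHom F F where
  θ := M.one ∘ₗ F.obj
  src_θ _ := M.src_one _
  tgt_θ _ := M.tgt_one _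
  nat f := by
    simp only [TwoVect.comp_eq, LinearMap.comp_apply, F.tgt_map, M.tgt_one]; abel
  coherence x y z := by
    simp only [TwoVect.comp_eq, LinearMap.comp_apply, F.tgt_F₂, M.br.map_one, M.tgt_one]; abel

/-- Vertical composition of 2-homomorphisms. -/
def vcomp {F G H : Hom L M} (σ : TwoHom F G) (ρ : TwoHom G H) : TwoHom F H where
  θ :=
    { toFun := fun x => M.comp (σ.θ x) (ρ.θ x) (by rw [σ.tgt_θ, ρ.src_θ])
      map_add' := fun x y => by
        simp only [TwoVect.comp_eq, map_add]; abel
      map_smul' := fun a x => by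
        simp only [TwoVect.comp_eq, map_smul, RingHom.id_apply]; module }
  src_θ x := (M.src_comp _ _ _).trans (σ.src_θ x)
  tgt_θ x := (M.tgt_comp _ _ _).trans (ρ.tgt_θ x)
  nat f := by
    have h1 := σ.nat f
    have h2 := ρ.nat f
    simp only [TwoVect.comp_eq, LinearMap.coe_mk, AddHom.coe_mk, map_add, map_sub, F.tgt_map,
      G.tgt_map, σ.tgt_θ, ρ.tgt_θ, M.tgt_one] at h1 h2 ⊢
    linear_combination (norm := module) h1 + h2
  coherence x y z := by
    have h1 := σ.coherence x y z
    have h2 := ρ.coherence x y z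
    simp only [LinearMap.coe_mk, AddHom.coe_mk, M.br.map_comp]
    simp only [TwoVect.comp_eq, map_add, map_sub, F.tgt_F₂, G.tgt_F₂,
      M.br.tgt_map, σ.tgt_θ, ρ.tgt_θ, M.tgt_one] at h1 h2 ⊢
    linear_combination (norm := module) h1 + h2

/-- Whiskering `σ : G ⇒ G'` with `F` on the source side, `x ↦ σ (F x)`. -/
def whiskerLeft (F : Hom L M) {G G' : Hom M N} (σ : TwoHom G G') :
    TwoHom (F.comp G) (F.comp G') where
  θ := σ.θ ∘ₗ F.obj
  src_θ x := σ.src_θ _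
  tgt_θ x := σ.tgt_θ _
  nat f := by
    have h := σ.nat (F.map f)
    simp only [TwoVect.comp_eq, F.tgt_map, F.src_map] at h
    simpa only [TwoVect.comp_eq, Hom.comp, compData, compFunctor, LinearMap.comp_apply] using h
  coherence x y z := by
    have h1 := σ.coherence (F.obj x) (F.obj y) (F.obj z)
    have h2 := σ.nat (F.F₂ x y z)
    simp only [TwoVect.comp_eq, F.tgt_F₂, F.src_F₂, G.tgt_F₂, G.tgt_map, σ.tgt_θ,
      N.br.tgt_map] at h1 h2
    simp only [TwoVect.comp_eq, Hom.comp, compData, compF₂_eq, LinearMap.comp_apply, map_add,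
      map_sub, G.tgt_F₂, G.tgt_map, F.tgt_F₂, N.tgt_one, N.br.tgt_map, σ.tgt_θ]
    linear_combination (norm := module) h1 + h2

/-- Whiskering `σ : F ⇒ F'` with `G` on the target side, `x ↦ G (σ x)`. -/
def whiskerRight {F F' : Hom L M} (σ : TwoHom F F') (G : Hom M N) :
    TwoHom (F.comp G) (F'.comp G) where
  θ := G.map ∘ₗ σ.θ
  src_θ x := (G.src_map _).trans (congrArg _ (σ.src_θ x))
  tgt_θ x := (G.tgt_map _).trans (congrArg _ (σ.tgt_θ x))
  nat f := by
    have h := congrArg G.map (σ.nat f)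
    simp only [G.map_comp] at h
    simpa only [Hom.comp, compData, compFunctor, LinearMap.comp_apply] using h
  coherence x y z := by
    have h1 := congrArg G.map (σ.coherence x y z)
    have h2 := G.F₂_nat (σ.θ x) (σ.θ y) (σ.θ z)
    simp only [TwoVect.comp_eq, F.tgt_F₂, G.tgt_F₂, G.tgt_map, σ.tgt_θ, σ.src_θ, map_add, map_sub,
      N.br.tgt_map, M.br.tgt_map, G.map_one] at h1 h2
    simp only [TwoVect.comp_eq, Hom.comp, compData, compF₂_eq, LinearMap.comp_apply, map_add,
      map_sub, G.tgt_F₂, G.tgt_map, F.tgt_F₂, N.tgt_one, N.br.tgt_map, σ.tgt_θ]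
    linear_combination (norm := module) h1 - h2

end TwoHom

instance : CategoryStruct (ThreeLieTwoAlg.{w, u} K) where
  Hom L M := Hom L M
  id L := Hom.id L
  comp F G := F.comp G

theorem vcomp_eq {F G H : Hom L M} (σ : TwoHom F G) (ρ : TwoHom G H) (x : L.C₀) :
    (σ.vcomp ρ).θ x = σ.θ x + ρ.θ x - M.one (G.obj x) :=
  (TwoVect.comp_eq _ _ _ _).trans (by rw [σ.tgt_θ])

instance : Category (L ⟶ M) where
  Hom F G := TwoHom F G
  id F := TwoHom.id F
  comp σ ρ := σ.vcomp ρ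
  id_comp {F _} σ := TwoHom.ext (LinearMap.ext fun x =>
    (vcomp_eq (TwoHom.id F) σ x).trans (add_sub_cancel_left (M.one (F.obj x)) (σ.θ x)))
  comp_id {_ G} σ := TwoHom.ext (LinearMap.ext fun x =>
    (vcomp_eq σ (TwoHom.id G) x).trans (add_sub_cancel_right (σ.θ x) (M.one (G.obj x))))
  assoc σ ρ π := TwoHom.ext (LinearMap.ext fun x => by
    simp only [vcomp_eq]; abel)

theorem two_hom_ext {F G : L ⟶ M} {σ ρ : F ⟶ G} (h : ∀ x, TwoHom.θ σ x = TwoHom.θ ρ x) :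
    σ = ρ :=
  TwoHom.ext (LinearMap.ext h)

theorem eqToHom_θ {F G : L ⟶ M} (h : F = G) (x : L.C₀) :
    TwoHom.θ (eqToHom h) x = M.one (F.obj x) := by
  subst h; rfl

theorem comp_θ {F G H : L ⟶ M} (σ : F ⟶ G) (ρ : G ⟶ H) (x : L.C₀) :
    TwoHom.θ (σ ≫ ρ) x = TwoHom.θ σ x + TwoHom.θ ρ x - M.one (G.obj x) :=
  vcomp_eq σ ρ x

theorem hom_id_comp (F : L ⟶ M) : 𝟙 L ≫ F = F :=
  Hom.ext' rfl rfl (by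
    funext x y z
    refine (compF₂_eq (Hom.id L) F x y z).trans ?_
    change F.F₂ x y z + F.map (L.one (L.br.obj x y z)) - M.one (F.obj (L.br.obj x y z)) = _
    rw [F.map_one, add_sub_cancel_right])

theorem hom_comp_id (F : L ⟶ M) : F ≫ 𝟙 M = F :=
  Hom.ext' rfl rfl (by
    funext x y z
    exact (compF₂_eq F (Hom.id M) x y z).trans (add_sub_cancel_left _ _))

theorem hom_assoc {P : ThreeLieTwoAlg.{w, u} K} (F : L ⟶ M) (G : M ⟶ N) (H : N ⟶ P) :
    (F ≫ G) ≫ H = F ≫ G ≫ H :=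
  Hom.ext' rfl rfl (by
    funext x y z
    change compF₂ (Hom.comp F G) H x y z = compF₂ F (Hom.comp G H) x y z
    simp only [compF₂_eq, Hom.comp, compData, compFunctor, LinearMap.comp_apply, map_add, map_sub]
    rw [H.map_one]
    abel)

/-- The 2-category of 3-Lie 2-algebras. -/
instance : Bicategory (ThreeLieTwoAlg.{w, u} K) where
  homCategory L M := inferInstance
  whiskerLeft F _ _ σ := TwoHom.whiskerLeft F σ
  whiskerRight σ G := TwoHom.whiskerRight σ G
  associator F G H := eqToIso (hom_assoc F G H)
  leftUnitor F := eqToIso (hom_id_comp F)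
  rightUnitor F := eqToIso (hom_comp_id F)
  whiskerLeft_id _ _ := rfl
  whiskerLeft_comp _ _ _ _ _ _ := rfl
  id_whiskerLeft {L M F G} σ := two_hom_ext fun x => by
    simp only [eqToIso.hom, eqToIso.inv, comp_θ, eqToHom_θ]
    change σ.θ x = M.one (F.obj x) + (σ.θ x + M.one (G.obj x) - M.one (G.obj x)) - M.one (F.obj x)
    abel
  comp_whiskerLeft {L M N P} F G H H' σ := two_hom_ext fun x => by
    simp only [eqToIso.hom, eqToIso.inv, comp_θ, eqToHom_θ]
    change σ.θ (G.obj (F.obj x)) = P.one (H.obj (G.obj (F.obj x)))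
      + (σ.θ (G.obj (F.obj x)) + P.one (H'.obj (G.obj (F.obj x)))
        - P.one (H'.obj (G.obj (F.obj x)))) - P.one (H.obj (G.obj (F.obj x)))
    abel
  id_whiskerRight F G := two_hom_ext fun x => G.map_one _
  comp_whiskerRight σ ρ G := two_hom_ext fun x => G.map_comp _ _ _
  whiskerRight_id {L M F G} σ := two_hom_ext fun x => by
    simp only [eqToIso.hom, eqToIso.inv, comp_θ, eqToHom_θ]
    change σ.θ x = M.one (F.obj x) + (σ.θ x + M.one (G.obj x) - M.one (G.obj x)) - M.one (F.obj x)
    abel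
  whiskerRight_comp {L M N P F F'} σ G H := two_hom_ext fun x => by
    simp only [eqToIso.hom, eqToIso.inv, comp_θ, eqToHom_θ]
    change H.map (G.map (σ.θ x)) = P.one (H.obj (G.obj (F.obj x)))
      + (H.map (G.map (σ.θ x)) + P.one (H.obj (G.obj (F'.obj x)))
        - P.one (H.obj (G.obj (F'.obj x)))) - P.one (H.obj (G.obj (F.obj x)))
    abel
  whisker_assoc {L M N P} F G G' σ H := two_hom_ext fun x => by
    simp only [eqToIso.hom, eqToIso.inv, comp_θ, eqToHom_θ]
    change H.map (σ.θ (F.obj x)) = P.one (H.obj (G.obj (F.obj x)))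
      + (H.map (σ.θ (F.obj x)) + P.one (H.obj (G'.obj (F.obj x)))
        - P.one (H.obj (G'.obj (F.obj x)))) - P.one (H.obj (G.obj (F.obj x)))
    abel
  whisker_exchange {L M N F F' G G'} σ ρ := two_hom_ext fun x => by
    have h := ρ.nat (σ.θ x)
    simp only [TwoVect.comp_eq, σ.tgt_θ, σ.src_θ, G.tgt_map, ρ.tgt_θ] at h
    simp only [comp_θ]
    exact h.symm
  pentagon {A B C D E} F G H I := two_hom_ext fun x => by
    simp only [eqToIso.hom, comp_θ, eqToHom_θ]
    have h1 : TwoHom.θ (TwoHom.whiskerRight (eqToHom (hom_assoc F G H)) I) x =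
        E.one (I.obj (H.obj (G.obj (F.obj x)))) :=
      (congrArg I.map (eqToHom_θ _ _)).trans (I.map_one _)
    have h2 : TwoHom.θ (TwoHom.whiskerLeft F (eqToHom (hom_assoc G H I))) x =
        E.one (I.obj (H.obj (G.obj (F.obj x)))) := eqToHom_θ _ _
    rw [h1, h2]
    change E.one (I.obj (H.obj (G.obj (F.obj x)))) + (E.one (I.obj (H.obj (G.obj (F.obj x))))
      + E.one (I.obj (H.obj (G.obj (F.obj x)))) - E.one (I.obj (H.obj (G.obj (F.obj x)))))
      - E.one (I.obj (H.obj (G.obj (F.obj x)))) = E.one (I.obj (H.obj (G.obj (F.obj x))))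
      + E.one (I.obj (H.obj (G.obj (F.obj x)))) - E.one (I.obj (H.obj (G.obj (F.obj x))))
    abel
  triangle {A B C} F G := two_hom_ext fun x => by
    simp only [eqToIso.hom, comp_θ, eqToHom_θ]
    have h1 : TwoHom.θ (TwoHom.whiskerRight (eqToHom (hom_comp_id F)) G) x =
        C.one (G.obj (F.obj x)) :=
      (congrArg G.map (eqToHom_θ _ _)).trans (G.map_one _)
    have h2 : TwoHom.θ (TwoHom.whiskerLeft F (eqToHom (hom_id_comp G))) x =
        C.one (G.obj (F.obj x)) := eqToHom_θ _ _
    rw [h1, h2]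
    exact add_sub_cancel_right _ _

instance : Bicategory.Strict (ThreeLieTwoAlg.{w, u} K) where
  id_comp := hom_id_comp
  comp_id := hom_comp_id
  assoc := hom_assoc
  leftUnitor_eqToIso _ := rfl
  rightUnitor_eqToIso _ := rfl
  associator_eqToIso _ _ _ := rfl

end ThreeLieTwoAlg

/-! ### 2-equivalence -/

section TwoEquivalence

universe w₁ v₁ u₁ w₂ v₂ u₂

/-- A 2-natural isomorphism between strict 2-functors of 2-categories: a family of isomorphisms
`F a ≅ G a`, strictly natural with respect to 1-morphisms and 2-morphisms. -/
structure TwoNatIso {B : Type u₁} [Bicategory.{w₁, v₁} B] {C : Type u₂} [Bicategory.{w₂, v₂} C]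
    (F G : StrictPseudofunctor B C) where
  hom : ∀ a : B, F.obj a ⟶ G.obj a
  inv : ∀ a : B, G.obj a ⟶ F.obj a
  hom_inv : ∀ a, hom a ≫ inv a = 𝟙 (F.obj a)
  inv_hom : ∀ a, inv a ≫ hom a = 𝟙 (G.obj a)
  naturality : ∀ {a b : B} (f : a ⟶ b), F.map f ≫ hom b = hom a ≫ G.map f
  naturality₂ : ∀ {a b : B} {f g : a ⟶ b} (η : f ⟶ g),
    F.map₂ η ▷ hom b ≫ eqToHom (naturality g) = eqToHom (naturality f) ≫ hom a ◁ G.map₂ η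

/-- A 2-equivalence of 2-categories: strict 2-functors in both directions whose composites are
2-naturally isomorphic to the identity 2-functors. -/
structure TwoEquivalence (B : Type u₁) [Bicategory.{w₁, v₁} B] [Bicategory.Strict B]
    (C : Type u₂) [Bicategory.{w₂, v₂} C] [Bicategory.Strict C] where
  functor : StrictPseudofunctor B C
  inverse : StrictPseudofunctor C B
  unitIso : TwoNatIso (StrictPseudofunctor.comp functor inverse) (StrictPseudofunctor.id B)
  counitIso : TwoNatIso (StrictPseudofunctor.comp inverse functor) (StrictPseudofunctor.id C)

end TwoEquivalence

end HigherLie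

/-! The underlying fact is that a 2-vector space is the same thing as a two-term complex. Every
arrow `f` splits uniquely as the identity of its source plus an arrow of source zero, and linearity
forces the composition law: by `TwoVect.comp_eq`, `f` followed by `g` is `f + g - 1`, with `1` the
identity of the middle object. Hence any commuting diagram of arrows is a linear equation in the
kernel of the source map. In one direction a complex gives the arrows `(x, f) : x ⟶ x + d f`; in the
other, a 2-vector space gives the target map restricted to the kernel of the source.

Under this dictionary the two kinds of structure match term by term. The part of source zero of the
Jacobiator is `l₅`, that of `F₂` is `φ₂`, and that of a natural transformation `θ` is `τ`. Condition
(a) gives the target of a bracket of arrows, (b) its skew-symmetry and functoriality, (c) the target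
of the Jacobiator, (d) its naturality, and (e) the equation between the two seven-variable
composites. Invertibility is automatic, since every arrow has an inverse.

Two points need work. A trilinear functor is determined by its values with two identity entries: an
arrow `[p, q, r]` is obtained by moving one argument at a time from source to target, which gives
the formula `brArrow`. That this is skew-symmetric and respects composition is the content of
`brMap_skew` and `brMap_comp`, and that every bracket functor has this form is `br_add_ker`, which
rests on `map_one_ker`. Secondly, (d) speaks of one argument at a time, whereas naturality of the
Jacobiator concerns five arrows at once; `natAt_of_single` bridges the gap by pasting squares.

The composite constructions return the original structures up to the isomorphisms `(0, f) ↦ f` and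
`(x, f) ↦ 1ₓ + f`. Both preserve brackets and Jacobiators on the nose, so they carry a trivial `φ₂`
or an identity `F₂`, and they are strictly 2-natural. -/

namespace HigherLie

/-! ### Scalars and signs in trilinear maps. -/

namespace IsTrilinear

variable {K : Type w} [Field K] {A B C D : Type u}
  [AddCommGroup A] [Module K A] [AddCommGroup B] [Module K B]
  [AddCommGroup C] [Module K C] [AddCommGroup D] [Module K D] {f : A → B → C → D}

theorem smul₁ (h : IsTrilinear K f) (y : B) (z : C) (a : K) (x : A) : f (a • x) y z = a • f x y z :=
  (h.lin₁ y z).map_smul a x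

theorem smul₂ (h : IsTrilinear K f) (x : A) (z : C) (a : K) (y : B) : f x (a • y) z = a • f x y z :=
  (h.lin₂ x z).map_smul a y

theorem smul₃ (h : IsTrilinear K f) (x : A) (y : B) (a : K) (z : C) : f x y (a • z) = a • f x y z :=
  (h.lin₃ x y).map_smul a z

theorem neg₃ (h : IsTrilinear K f) (x : A) (y : B) (z : C) : f x y (-z) = -f x y z :=
  (h.lin₃ x y).map_neg z

end IsTrilinear

/-! ### From 2-term 3-Lie-infinity-algebras to 3-Lie 2-algebras -/

namespace TwoTermThreeLieInfAlg

variable {K : Type w} [Field K] (V : TwoTermThreeLieInfAlg.{w, u} K)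

/-- Condition (b) in terms of `l₃'`, whose argument from `V₁` always stands last. Combined with
skew-symmetry in the first two slots, it lets the differential pass between two arguments from `V₁`;
the sign depends on the slots involved, hence the three variants. -/
theorem l₃'_d₁ (f g : V.V₁) (x : V.V₀) : V.l₃' (V.d f) x g = -V.l₃' (V.d g) x f := by
  have h := V.l₃_d f g x
  simp only [TwoTermData.l₃₀₁₀, TwoTermData.l₃₁₀₀] at h
  rw [← h, neg_neg]

theorem l₃'_d₂ (f g : V.V₁) (x : V.V₀) : V.l₃' x (V.d f) g = -V.l₃' x (V.d g) f := by
  rw [V.l₃'_skew, V.l₃'_d₁, V.l₃'_skew x, neg_neg]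

theorem l₃'_d₁₂ (f g : V.V₁) (x : V.V₀) : V.l₃' (V.d f) x g = V.l₃' x (V.d g) f := by
  rw [V.l₃'_d₁, V.l₃'_skew x, neg_neg]

/-- The target of an arrow of the 2-vector space of a complex. -/
def arrowTgt : V.V₀ × V.V₁ →ₗ[K] V.V₀ := LinearMap.fst K _ _ + V.d ∘ₗ LinearMap.snd K _ _

@[simp]
theorem arrowTgt_apply (p : V.V₀ × V.V₁) : V.arrowTgt p = p.1 + V.d p.2 := rfl

/-- The 2-vector space of a complex `V₁ → V₀`: an arrow `x ⟶ x + d f` is a pair `(x, f)`. -/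
def twoVect : TwoVect.{w, u} K where
  C₀ := V.V₀
  C₁ := V.V₀ × V.V₁
  src := LinearMap.fst K _ _
  tgt := V.arrowTgt
  one := LinearMap.inl K _ _
  comp f g _ := (f.1, f.2 + g.2)
  src_one _ := rfl
  tgt_one x := by simp
  src_comp _ _ _ := rfl
  tgt_comp f g h := by
    change f.1 + V.d f.2 = g.1 at h
    change f.1 + V.d (f.2 + g.2) = g.1 + V.d g.2
    rw [← h, map_add, add_assoc]
  one_comp f := Prod.ext rfl (zero_add _)
  comp_one f := Prod.ext rfl (add_zero _)
  assoc f g k _ _ := Prod.ext rfl (add_assoc f.2 g.2 k.2)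
  comp_add f g f' g' _ _ := Prod.ext rfl (add_add_add_comm f.2 f'.2 g.2 g'.2)
  comp_smul a f g _ := Prod.ext rfl (smul_add a f.2 g.2).symm

/-- The component in `V₁` of the bracket of three arrows. -/
def brArrow (p q r : V.V₀ × V.V₁) : V.V₁ :=
  V.l₃' q.1 r.1 p.2 - V.l₃' (p.1 + V.d p.2) r.1 q.2 + V.l₃' (p.1 + V.d p.2) (q.1 + V.d q.2) r.2

/-- The bracket of three arrows. -/
def brMap (p q r : V.V₀ × V.V₁) : V.V₀ × V.V₁ := (V.l₃ p.1 q.1 r.1, V.brArrow p q r)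

theorem brMap_lin : IsTrilinear K V.brMap := by
  have h := V.l₃_lin
  have h' := V.l₃'_lin
  constructor <;> intros <;> constructor <;> intros <;> ext <;>
    simp only [brMap, brArrow, Prod.fst_add, Prod.snd_add, Prod.smul_fst, Prod.smul_snd, map_add,
      map_smul, h.add₁, h.add₂, h.add₃, h.smul₁, h.smul₂, h.smul₃, h'.add₁, h'.add₂, h'.add₃,
      h'.smul₁, h'.smul₂, h'.smul₃] <;> module

/-- `brArrow` moves the first argument to its target, then the second, then the third. Skew-symmetry
expresses that this order is immaterial, and that is what (b) provides. -/
theorem brMap_skew : IsSkew₃ V.brMap := by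
  have h' := V.l₃'_lin
  constructor <;> intro p q r <;> refine Prod.ext ?_ ?_
  · exact V.l₃_skew.swap₁₂ _ _ _
  · simp only [brMap, brArrow, Prod.snd_neg, h'.add₁, h'.add₂]
    linear_combination (norm := module) V.l₃'_skew p.1 q.1 r.2
      + V.l₃'_skew (V.d p.2) (V.d q.2) r.2 + V.l₃'_skew p.1 (V.d q.2) r.2
      + V.l₃'_skew (V.d p.2) q.1 r.2 - V.l₃'_d₁ q.2 p.2 r.1
  · exact V.l₃_skew.swap₂₃ _ _ _
  · simp only [brMap, brArrow, Prod.snd_neg, h'.add₁, h'.add₂]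
    linear_combination (norm := module) V.l₃'_skew q.1 r.1 p.2 + V.l₃'_d₂ q.2 r.2 p.1
      + V.l₃'_d₂ q.2 r.2 (V.d p.2)

/-- By (a) the differentials of the three terms of `brArrow` telescope, each replacing one more
source by a target. -/
theorem arrowTgt_brMap (p q r : V.V₀ × V.V₁) :
    V.arrowTgt (V.brMap p q r) = V.l₃ (V.arrowTgt p) (V.arrowTgt q) (V.arrowTgt r) := by
  have h := V.l₃_lin
  have s := V.l₃_skew
  simp only [arrowTgt_apply, brMap, brArrow, map_add, map_sub, V.d_l₃, h.add₁, h.add₂, h.add₃]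
  linear_combination (norm := module) s.cycle (V.d p.2) q.1 r.1 - s.swap₂₃ p.1 (V.d q.2) r.1
    - s.swap₂₃ (V.d p.2) (V.d q.2) r.1

/-- An interchange law. After expansion over sources and differentials, the two sides differ only in
terms that pair a later arrow with an earlier one in another slot (`p'` with `q` or `r`, and `q'`
with `r`), and (b) identifies these. -/
theorem brMap_comp (p q r p' q' r' : V.V₀ × V.V₁) (hp : V.arrowTgt p = p'.1)
    (hq : V.arrowTgt q = q'.1) (hr : V.arrowTgt r = r'.1) :
    V.brArrow (p.1, p.2 + p'.2) (q.1, q.2 + q'.2) (r.1, r.2 + r'.2) =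
      V.brArrow p q r + V.brArrow p' q' r' := by
  have h' := V.l₃'_lin
  simp only [arrowTgt_apply] at hp hq hr
  simp only [brArrow, ← hp, ← hq, ← hr, map_add, h'.add₁, h'.add₂, h'.add₃]
  linear_combination (norm := module) -V.l₃'_d₁ p'.2 q.2 r.1 + V.l₃'_d₁₂ p'.2 r.2 q.1
    + V.l₃'_d₂ q'.2 r.2 p.1 + V.l₃'_d₂ q'.2 r.2 (V.d p.2) + V.l₃'_d₁₂ p'.2 r.2 (V.d q.2)
    + V.l₃'_d₂ q'.2 r.2 (V.d p'.2)

theorem brArrow_one (x y z : V.V₀) : V.brArrow (x, 0) (y, 0) (z, 0) = 0 := by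
  simp [brArrow, V.l₃'_lin.zero₃]

/-- The bracket functor. -/
def triFunctor : V.twoVect.TriFunctor where
  obj := V.l₃
  map := V.brMap
  obj_lin := V.l₃_lin
  map_lin := V.brMap_lin
  obj_skew := V.l₃_skew
  map_skew := V.brMap_skew
  src_map _ _ _ := rfl
  tgt_map := V.arrowTgt_brMap
  map_one x y z := Prod.ext rfl (V.brArrow_one x y z)
  map_comp p q r p' q' r' hp hq hr := Prod.ext rfl (V.brMap_comp p q r p' q' r' hp hq hr)

end TwoTermThreeLieInfAlg

/-! ### Naturality of a Jacobiator, one variable at a time. -/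

namespace TwoVect.TriFunctor

variable {K : Type w} [Field K] {C : TwoVect.{w, u} K} (b : C.TriFunctor)
  (J : C.C₀ → C.C₀ → C.C₀ → C.C₀ → C.C₀ → C.C₁)

/-- The arrow `[[f₁, f₂, f₃], f₄, f₅] + [f₃, [f₁, f₂, f₄], f₅] + [f₃, f₄, [f₁, f₂, f₅]]`. -/
def derived (f₁ f₂ f₃ f₄ f₅ : C.C₁) : C.C₁ :=
  b.map (b.map f₁ f₂ f₃) f₄ f₅ + b.map f₃ (b.map f₁ f₂ f₄) f₅ + b.map f₃ f₄ (b.map f₁ f₂ f₅)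

/-- The naturality square at `f₁, …, f₅` of a family of arrows `J` from `[x₁, x₂, [x₃, x₄, x₅]]` to
`[[x₁, x₂, x₃], x₄, x₅] + [x₃, [x₁, x₂, x₄], x₅] + [x₃, x₄, [x₁, x₂, x₅]]`. -/
def NatAt (f₁ f₂ f₃ f₄ f₅ : C.C₁) : Prop :=
  b.map f₁ f₂ (b.map f₃ f₄ f₅) + J (C.tgt f₁) (C.tgt f₂) (C.tgt f₃) (C.tgt f₄) (C.tgt f₅)
      - C.one (C.tgt (b.map f₁ f₂ (b.map f₃ f₄ f₅))) =
    J (C.src f₁) (C.src f₂) (C.src f₃) (C.src f₄) (C.src f₅) + b.derived f₁ f₂ f₃ f₄ f₅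
      - C.one (C.src (b.derived f₁ f₂ f₃ f₄ f₅))

variable {J}

/-- Pasting of naturality squares. As composition is addition corrected by an identity, the pasted
square is the sum of the two equations: the values of `J` at the middle objects cancel, and so do
the surplus identities. -/
theorem NatAt.comp {f₁ f₂ f₃ f₄ f₅ g₁ g₂ g₃ g₄ g₅ : C.C₁} (hf : b.NatAt J f₁ f₂ f₃ f₄ f₅)
    (hg : b.NatAt J g₁ g₂ g₃ g₄ g₅) (h₁ : C.tgt f₁ = C.src g₁) (h₂ : C.tgt f₂ = C.src g₂)
    (h₃ : C.tgt f₃ = C.src g₃) (h₄ : C.tgt f₄ = C.src g₄) (h₅ : C.tgt f₅ = C.src g₅) :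
    b.NatAt J (C.comp f₁ g₁ h₁) (C.comp f₂ g₂ h₂) (C.comp f₃ g₃ h₃) (C.comp f₄ g₄ h₄)
      (C.comp f₅ g₅ h₅) := by
  unfold NatAt derived at *
  simp only [b.map_comp, map_add, C.src_comp, C.tgt_comp]
  simp only [comp_eq, map_add, b.tgt_map, b.src_map, h₁, h₂, h₃, h₄, h₅] at hf hg ⊢
  linear_combination (norm := module) hf + hg

/-- Naturality in five variables follows from naturality in each of them. -/
theorem natAt_of_single
    (n₁ : ∀ f x₂ x₃ x₄ x₅, b.NatAt J f (C.one x₂) (C.one x₃) (C.one x₄) (C.one x₅))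
    (n₂ : ∀ x₁ f x₃ x₄ x₅, b.NatAt J (C.one x₁) f (C.one x₃) (C.one x₄) (C.one x₅))
    (n₃ : ∀ x₁ x₂ f x₄ x₅, b.NatAt J (C.one x₁) (C.one x₂) f (C.one x₄) (C.one x₅))
    (n₄ : ∀ x₁ x₂ x₃ f x₅, b.NatAt J (C.one x₁) (C.one x₂) (C.one x₃) f (C.one x₅))
    (n₅ : ∀ x₁ x₂ x₃ x₄ f, b.NatAt J (C.one x₁) (C.one x₂) (C.one x₃) (C.one x₄) f)
    (f₁ f₂ f₃ f₄ f₅ : C.C₁) : b.NatAt J f₁ f₂ f₃ f₄ f₅ := by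
  have hs : ∀ f, C.tgt (C.one (C.src f)) = C.src f := fun f => C.tgt_one _
  have ht : ∀ f, C.tgt f = C.src (C.one (C.tgt f)) := fun f => (C.src_one _).symm
  -- The quintuple factors into five steps, the `k`-th having `f_k` in slot `k`, identities of
  -- targets before it and identities of sources after it. `m_k` is the square for the composite of
  -- the first `k` steps.
  have m₂ := (n₁ f₁ (C.src f₂) (C.src f₃) (C.src f₄) (C.src f₅)).comp b
    (n₂ (C.tgt f₁) f₂ (C.src f₃) (C.src f₄) (C.src f₅)) (ht _) (hs _)
    ((hs _).trans (C.src_one _).symm) ((hs _).trans (C.src_one _).symm)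
    ((hs _).trans (C.src_one _).symm)
  have one_one : ∀ x h, C.comp (C.one x) (C.one x) h = C.one x := fun x h => by
    rw [comp_eq, C.tgt_one, add_sub_cancel_right]
  simp only [C.comp_one, C.one_comp, one_one] at m₂
  have m₃ := m₂.comp b (n₃ (C.tgt f₁) (C.tgt f₂) f₃ (C.src f₄) (C.src f₅)) (ht _) (ht _) (hs _)
    ((hs _).trans (C.src_one _).symm) ((hs _).trans (C.src_one _).symm)
  simp only [C.comp_one, C.one_comp, one_one] at m₃
  have m₄ := m₃.comp b (n₄ (C.tgt f₁) (C.tgt f₂) (C.tgt f₃) f₄ (C.src f₅)) (ht _) (ht _) (ht _)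
    (hs _) ((hs _).trans (C.src_one _).symm)
  simp only [C.comp_one, C.one_comp, one_one] at m₄
  have m₅ := m₄.comp b (n₅ (C.tgt f₁) (C.tgt f₂) (C.tgt f₃) (C.tgt f₄) f₅) (ht _) (ht _) (ht _)
    (ht _) (hs _)
  simpa only [C.comp_one, C.one_comp] using m₅

end TwoVect.TriFunctor

/-! ### The Jacobiator built from `l₅` and its coherence. -/

namespace TwoTermThreeLieInfAlg

variable {K : Type w} [Field K] (V : TwoTermThreeLieInfAlg.{w, u} K)

/-- The Jacobiator `(l₃(x₁, x₂, l₃(x₃, x₄, x₅)), l₅(x₁, …, x₅))`. -/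
def jac (x₁ x₂ x₃ x₄ x₅ : V.V₀) : V.V₀ × V.V₁ :=
  (V.l₃ x₁ x₂ (V.l₃ x₃ x₄ x₅), V.l₅ x₁ x₂ x₃ x₄ x₅)

theorem jac_lin : IsQuintilinear K V.jac := by
  have h := V.l₃_lin
  have h' := V.l₅_lin
  constructor <;> intros <;> constructor <;> intros <;> refine Prod.ext ?_ ?_
  all_goals first
    | exact (h'.lin₁ _ _ _ _).map_add _ _ | exact (h'.lin₂ _ _ _ _).map_add _ _
    | exact (h'.lin₃ _ _ _ _).map_add _ _ | exact (h'.lin₄ _ _ _ _).map_add _ _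
    | exact (h'.lin₅ _ _ _ _).map_add _ _ | exact (h'.lin₁ _ _ _ _).map_smul _ _
    | exact (h'.lin₂ _ _ _ _).map_smul _ _ | exact (h'.lin₃ _ _ _ _).map_smul _ _
    | exact (h'.lin₄ _ _ _ _).map_smul _ _ | exact (h'.lin₅ _ _ _ _).map_smul _ _
    | simp only [jac, Prod.fst_add, Prod.smul_fst, h.add₁, h.add₂, h.add₃, h.smul₁, h.smul₂,
        h.smul₃]

theorem jac_skew : IsSkew₂₃ V.jac := by
  have h := V.l₃_lin
  have s := V.l₃_skew
  constructor <;> intro a b c d e <;> refine Prod.ext ?_ ?_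
  · exact s.swap₁₂ _ _ _
  · exact V.l₅_skew.swap₁₂ _ _ _ _ _
  · exact (congrArg _ (s.swap₁₂ c d e)).trans (h.neg₃ _ _ _)
  · exact V.l₅_skew.swap₃₄ _ _ _ _ _
  · exact (congrArg _ (s.swap₂₃ c d e)).trans (h.neg₃ _ _ _)
  · exact V.l₅_skew.swap₄₅ _ _ _ _ _

theorem arrowTgt_jac (x₁ x₂ x₃ x₄ x₅ : V.V₀) : V.arrowTgt (V.jac x₁ x₂ x₃ x₄ x₅) =
    V.l₃ (V.l₃ x₁ x₂ x₃) x₄ x₅ + V.l₃ x₃ (V.l₃ x₁ x₂ x₄) x₅ + V.l₃ x₃ x₄ (V.l₃ x₁ x₂ x₅) := by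
  simp only [arrowTgt_apply, jac, V.d_l₅]
  abel

/-- Both composites of the square start at the same object, so only their components in `V₁` need
comparing, and there identities contribute zero. -/
theorem natAt_of_snd (p₁ p₂ p₃ p₄ p₅ : V.V₀ × V.V₁)
    (h : V.brArrow p₁ p₂ (V.brMap p₃ p₄ p₅)
        + V.l₅ (V.arrowTgt p₁) (V.arrowTgt p₂) (V.arrowTgt p₃) (V.arrowTgt p₄) (V.arrowTgt p₅) =
      V.l₅ p₁.1 p₂.1 p₃.1 p₄.1 p₅.1 + (V.brArrow (V.brMap p₁ p₂ p₃) p₄ p₅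
        + V.brArrow p₃ (V.brMap p₁ p₂ p₄) p₅ + V.brArrow p₃ p₄ (V.brMap p₁ p₂ p₅))) :
    V.triFunctor.NatAt V.jac p₁ p₂ p₃ p₄ p₅ := by
  refine Prod.ext ?_ ?_
  · change V.l₃ p₁.1 p₂.1 (V.l₃ p₃.1 p₄.1 p₅.1)
      + V.l₃ (V.arrowTgt p₁) (V.arrowTgt p₂) (V.l₃ (V.arrowTgt p₃) (V.arrowTgt p₄) (V.arrowTgt p₅))
      - V.arrowTgt (V.brMap p₁ p₂ (V.brMap p₃ p₄ p₅)) = V.l₃ p₁.1 p₂.1 (V.l₃ p₃.1 p₄.1 p₅.1)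
      + (V.l₃ (V.l₃ p₁.1 p₂.1 p₃.1) p₄.1 p₅.1 + V.l₃ p₃.1 (V.l₃ p₁.1 p₂.1 p₄.1) p₅.1
        + V.l₃ p₃.1 p₄.1 (V.l₃ p₁.1 p₂.1 p₅.1))
      - (V.l₃ (V.l₃ p₁.1 p₂.1 p₃.1) p₄.1 p₅.1 + V.l₃ p₃.1 (V.l₃ p₁.1 p₂.1 p₄.1) p₅.1
        + V.l₃ p₃.1 p₄.1 (V.l₃ p₁.1 p₂.1 p₅.1))
    rw [V.arrowTgt_brMap, V.arrowTgt_brMap, add_sub_cancel_right, add_sub_cancel_right]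
  · exact (sub_zero _).trans (h.trans (sub_zero _).symm)

theorem l₅_add₁ (x y b c d e : V.V₀) : V.l₅ (x + y) b c d e = V.l₅ x b c d e + V.l₅ y b c d e :=
  (V.l₅_lin.lin₁ b c d e).map_add x y

theorem l₅_add₃ (a b x y d e : V.V₀) : V.l₅ a b (x + y) d e = V.l₅ a b x d e + V.l₅ a b y d e :=
  (V.l₅_lin.lin₃ a b d e).map_add x y

/-- With a single nonidentity arrow `f`, the square computes `l₅` with `d f.2` in the corresponding
slot. For the first and third slots this is (d); the second slot reduces to the first, and the
fourth and fifth to the third, by skew-symmetry of `l₅`. -/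
theorem natAt_single₁ (f : V.V₀ × V.V₁) (x₂ x₃ x₄ x₅ : V.V₀) :
    V.triFunctor.NatAt V.jac f (x₂, 0) (x₃, 0) (x₄, 0) (x₅, 0) := by
  have h := V.l₃'_lin
  refine V.natAt_of_snd f (x₂, 0) (x₃, 0) (x₄, 0) (x₅, 0) ?_
  have e := V.l₅_d₁ f.2 x₂ x₃ x₄ x₅
  simp only [arrowTgt_apply, brMap, brArrow, map_zero, add_zero, h.zero₃, sub_zero, zero_sub,
    TwoTermData.l₃₁₀₀, TwoTermData.l₃₀₁₀, V.l₅_add₁] at e ⊢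
  linear_combination (norm := module) e

theorem natAt_single₂ (f : V.V₀ × V.V₁) (x₁ x₃ x₄ x₅ : V.V₀) :
    V.triFunctor.NatAt V.jac (x₁, 0) f (x₃, 0) (x₄, 0) (x₅, 0) := by
  have h := V.l₃'_lin
  refine V.natAt_of_snd (x₁, 0) f (x₃, 0) (x₄, 0) (x₅, 0) ?_
  have e := V.l₅_d₁ f.2 x₁ x₃ x₄ x₅
  simp only [arrowTgt_apply, brMap, brArrow, map_zero, add_zero, h.zero₃, sub_zero, zero_add,
    zero_sub, h.neg₃, TwoTermData.l₃₁₀₀, TwoTermData.l₃₀₁₀,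
    V.l₅_skew.swap₁₂ _ x₁, V.l₅_add₁] at e ⊢
  linear_combination (norm := module) -e

theorem natAt_single₃ (f : V.V₀ × V.V₁) (x₁ x₂ x₄ x₅ : V.V₀) :
    V.triFunctor.NatAt V.jac (x₁, 0) (x₂, 0) f (x₄, 0) (x₅, 0) := by
  have h := V.l₃'_lin
  refine V.natAt_of_snd (x₁, 0) (x₂, 0) f (x₄, 0) (x₅, 0) ?_
  have e := V.l₅_d₃ f.2 x₁ x₂ x₄ x₅
  simp only [arrowTgt_apply, brMap, brArrow, map_zero, add_zero, h.zero₃, sub_zero, zero_add,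
    sub_self, TwoTermData.l₃₁₀₀, V.l₅_add₃] at e ⊢
  linear_combination (norm := module) e

theorem natAt_single₄ (f : V.V₀ × V.V₁) (x₁ x₂ x₃ x₅ : V.V₀) :
    V.triFunctor.NatAt V.jac (x₁, 0) (x₂, 0) (x₃, 0) f (x₅, 0) := by
  have h := V.l₃'_lin
  refine V.natAt_of_snd (x₁, 0) (x₂, 0) (x₃, 0) f (x₅, 0) ?_
  have e := V.l₅_d₃ f.2 x₁ x₂ x₃ x₅
  have a := V.l₅_skew.swap₃₄ x₁ x₂ (V.d f.2) x₃ x₅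
  have b := (V.l₅_lin.lin₄ x₁ x₂ x₃ x₅).map_add f.1 (V.d f.2)
  simp only [arrowTgt_apply, brMap, brArrow, map_zero, add_zero, h.zero₃, sub_zero, zero_add,
    zero_sub, h.neg₃, TwoTermData.l₃₁₀₀, b] at e ⊢
  linear_combination (norm := module) a - e

theorem natAt_single₅ (f : V.V₀ × V.V₁) (x₁ x₂ x₃ x₄ : V.V₀) :
    V.triFunctor.NatAt V.jac (x₁, 0) (x₂, 0) (x₃, 0) (x₄, 0) f := by
  have h := V.l₃'_lin
  refine V.natAt_of_snd (x₁, 0) (x₂, 0) (x₃, 0) (x₄, 0) f ?_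
  have e := V.l₅_d₃ f.2 x₁ x₂ x₃ x₄
  have a := V.l₅_skew.swap₄₅ x₁ x₂ x₃ (V.d f.2) x₄
  have a' := V.l₅_skew.swap₃₄ x₁ x₂ (V.d f.2) x₃ x₄
  have b := (V.l₅_lin.lin₅ x₁ x₂ x₃ x₄).map_add f.1 (V.d f.2)
  simp only [arrowTgt_apply, brMap, brArrow, map_zero, add_zero, h.zero₃, zero_add,
    sub_self, TwoTermData.l₃₁₀₀, b] at e ⊢
  linear_combination (norm := module) a - a' + e

theorem jac_nat (p₁ p₂ p₃ p₄ p₅ : V.twoVect.C₁) :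
    V.triFunctor.NatAt V.jac p₁ p₂ p₃ p₄ p₅ :=
  V.triFunctor.natAt_of_single (J := V.jac) V.natAt_single₁ (fun x₁ f => V.natAt_single₂ f x₁)
    (fun x₁ x₂ f => V.natAt_single₃ f x₁ x₂) (fun x₁ x₂ x₃ f => V.natAt_single₄ f x₁ x₂ x₃)
    (fun x₁ x₂ x₃ x₄ f => V.natAt_single₅ f x₁ x₂ x₃ x₄) p₁ p₂ p₃ p₄ p₅

/-- The underlying data of the 3-Lie 2-algebra of a 2-term 3-Lie-infinity-algebra. -/
def twoData : ThreeLieTwoData.{w, u} K where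
  toTwoVect := V.twoVect
  br := V.triFunctor
  J := V.jac
  J_lin := V.jac_lin
  J_skew := V.jac_skew
  src_J _ _ _ _ _ := rfl
  tgt_J := V.arrowTgt_jac
  J_nat p₁ p₂ p₃ p₄ p₅ := by
    have h := V.jac_nat p₁ p₂ p₃ p₄ p₅
    refine (TwoVect.comp_eq _ _ _ _).trans (h.trans ?_)
    refine ((TwoVect.comp_eq _ _ _ _).trans ?_).symm
    -- The two expressions subtract the identity of the same middle object, written once as the
    -- target of the Jacobiator and once as the source of the derived arrow.
    refine congrArg (fun x => _ - V.twoVect.one x) ?_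
    exact (V.arrowTgt_jac _ _ _ _ _).trans (V.triFunctor.src_nested p₁ p₂ p₃ p₄ p₅).symm
  J_iso x₁ x₂ x₃ x₄ x₅ := by
    -- The inverse of any arrow `(x, f)` is `(x + d f, -f)`.
    refine ⟨(V.arrowTgt (V.jac x₁ x₂ x₃ x₄ x₅), -V.l₅ x₁ x₂ x₃ x₄ x₅), rfl, ?_, ?_, ?_⟩
    · exact (congrArg _ (map_neg V.d _)).trans (add_neg_cancel_right _ _)
    · exact Prod.ext rfl (add_neg_cancel _)
    · exact Prod.ext rfl (neg_add_cancel _)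

/-- Components in `V₁` add under composition, so the equation of the two seven-variable composites
becomes (e). The parentheses follow the nesting of those composites and each `+ 0` comes from an
identity arrow, so that the statement is their second component by definition. -/
theorem brArrow_coherence (x₁ x₂ x₃ x₄ x₅ x₆ x₇ : V.V₀) :
    V.brArrow (x₁, 0) (x₂, 0) (V.jac x₃ x₄ x₅ x₆ x₇)
      + ((V.l₅ x₁ x₂ (V.l₃ x₃ x₄ x₅) x₆ x₇ + V.l₅ x₁ x₂ x₅ (V.l₃ x₃ x₄ x₆) x₇
          + V.l₅ x₁ x₂ x₅ x₆ (V.l₃ x₃ x₄ x₇))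
        + ((V.brArrow (x₅, 0) (x₆, 0) (V.jac x₁ x₂ x₃ x₄ x₇) + 0)
          + (V.brArrow (x₅, 0) (V.jac x₁ x₂ x₃ x₄ x₆) (x₇, 0)
            + V.brArrow (V.jac x₁ x₂ x₃ x₄ x₅) (x₆, 0) (x₇, 0) + 0)))
      = V.l₅ x₁ x₂ x₃ x₄ (V.l₃ x₅ x₆ x₇)
        + ((V.brArrow (x₃, 0) (x₄, 0) (V.jac x₁ x₂ x₅ x₆ x₇) + 0)
          + (V.l₅ (V.l₃ x₁ x₂ x₃) x₄ x₅ x₆ x₇ + V.l₅ x₃ (V.l₃ x₁ x₂ x₄) x₅ x₆ x₇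
            + V.l₅ x₃ x₄ (V.l₃ x₁ x₂ x₅) x₆ x₇ + V.l₅ x₃ x₄ x₅ (V.l₃ x₁ x₂ x₆) x₇
            + V.l₅ x₃ x₄ x₅ x₆ (V.l₃ x₁ x₂ x₇))) := by
  have h := V.l₃'_lin
  have e := V.coherence x₁ x₂ x₃ x₄ x₅ x₆ x₇
  simp only [jac, brArrow, map_zero, add_zero, h.zero₃, sub_zero, zero_sub, zero_add,
    TwoTermData.l₃₁₀₀, TwoTermData.l₃₀₁₀] at e ⊢
  linear_combination (norm := module) e

/-- The 3-Lie 2-algebra of a 2-term 3-Lie-infinity-algebra. -/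
def toTwoAlg : ThreeLieTwoAlg.{w, u} K where
  toThreeLieTwoData := V.twoData
  fundamentor x₁ x₂ x₃ x₄ x₅ x₆ x₇ :=
    Prod.ext rfl (V.brArrow_coherence x₁ x₂ x₃ x₄ x₅ x₆ x₇)

end TwoTermThreeLieInfAlg

/-! ### From 3-Lie 2-algebras to 2-term 3-Lie-infinity-algebras -/

namespace ThreeLieTwoAlg

variable {K : Type w} [Field K] (L : ThreeLieTwoAlg.{w, u} K)

/-- If `g` has source zero, then `[1, g, h] = [f, g, h]` with `1` the identity of the target
of `f`. -/
theorem map_one_ker {f g : L.C₁} (hg : L.src g = 0) (h : L.C₁) :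
    L.br.map (L.one (L.tgt f)) g h = L.br.map f g h := by
  -- The triple `(f, g, h)` factors as `(f, 0, 1)` followed by `(1, g, h)`, where `0` can precede
  -- `g` because `g` has source zero. The bracket of the first triple vanishes by linearity.
  have e := L.br.map_comp f 0 (L.one (L.src h)) (L.one (L.tgt f)) g h (L.src_one _).symm
    ((map_zero _).trans hg.symm) (L.tgt_one _)
  simpa only [TwoVect.comp_eq, L.br.tgt_map, L.tgt_one, map_zero, L.br.obj_lin.zero₂, sub_zero,
    zero_add, add_sub_cancel_right, add_sub_cancel_left, L.br.map_lin.zero₂] using e.symm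

theorem map_ker_one {f g : L.C₁} (hf : L.src f = 0) (h : L.C₁) :
    L.br.map f (L.one (L.tgt g)) h = L.br.map f g h := by
  rw [L.br.map_skew.swap₁₂ (L.one (L.tgt g)), L.map_one_ker hf, L.br.map_skew.swap₁₂ f, neg_neg]

/-- The bracket of two objects with an arrow of source zero. -/
def kerBr (x y : L.C₀) (f : LinearMap.ker L.src) : LinearMap.ker L.src :=
  ⟨L.br.map (L.one x) (L.one y) f, by
    rw [LinearMap.mem_ker, L.br.src_map, LinearMap.mem_ker.1 f.2, L.br.obj_lin.zero₃]⟩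

/-- The part of the Jacobiator with source zero. -/
def kerJ (x₁ x₂ x₃ x₄ x₅ : L.C₀) : LinearMap.ker L.src :=
  ⟨L.J x₁ x₂ x₃ x₄ x₅ - L.one (L.br.obj x₁ x₂ (L.br.obj x₃ x₄ x₅)), by
    rw [LinearMap.mem_ker, map_sub, L.src_J, L.src_one, sub_self]⟩

theorem kerBr_lin : IsTrilinear K L.kerBr := by
  have h := L.br.map_lin
  constructor <;> intros <;> constructor <;> intros <;> refine Subtype.ext ?_ <;>
    simp only [kerBr, map_add, map_smul, Submodule.coe_add, Submodule.coe_smul, h.add₁, h.add₂,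
      h.add₃, h.smul₁, h.smul₂, h.smul₃]

theorem kerJ_lin : IsQuintilinear K L.kerJ := by
  have h := L.br.obj_lin
  have j := L.J_lin
  constructor <;> intros <;> constructor <;> intros <;> refine Subtype.ext ?_ <;>
    simp only [kerJ, Submodule.coe_add, Submodule.coe_smul, h.add₁, h.add₂,
      h.add₃, h.smul₁, h.smul₂, h.smul₃, map_add, map_smul, (j.lin₁ _ _ _ _).map_add,
      (j.lin₂ _ _ _ _).map_add, (j.lin₃ _ _ _ _).map_add, (j.lin₄ _ _ _ _).map_add,
      (j.lin₅ _ _ _ _).map_add, (j.lin₁ _ _ _ _).map_smul, (j.lin₂ _ _ _ _).map_smul,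
      (j.lin₃ _ _ _ _).map_smul, (j.lin₄ _ _ _ _).map_smul, (j.lin₅ _ _ _ _).map_smul] <;>
    module

theorem kerJ_skew : IsSkew₂₃ L.kerJ := by
  have h := L.br.obj_lin
  have s := L.br.obj_skew
  have j := L.J_skew
  constructor <;> intro a b c d e <;> refine Subtype.ext ?_ <;>
    simp only [kerJ, Submodule.coe_neg]
  · rw [j.swap₁₂, s.swap₁₂ a, map_neg]; abel
  · rw [j.swap₃₄, s.swap₁₂ c, h.neg₃, map_neg]; abel
  · rw [j.swap₄₅, s.swap₂₃ c, h.neg₃, map_neg]; abel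

/-- The underlying data of the 2-term 3-Lie-infinity-algebra of a 3-Lie 2-algebra. -/
def termData : TwoTermData.{w, u} K where
  V₀ := L.C₀
  V₁ := LinearMap.ker L.src
  d := L.tgt ∘ₗ (LinearMap.ker L.src).subtype
  l₃ := L.br.obj
  l₃_lin := L.br.obj_lin
  l₃_skew := L.br.obj_skew
  l₃' := L.kerBr
  l₃'_lin := L.kerBr_lin
  l₃'_skew x y _ := Subtype.ext (L.br.map_skew.swap₁₂ (L.one x) (L.one y) _)
  l₅ := L.kerJ
  l₅_lin := L.kerJ_lin
  l₅_skew := L.kerJ_skew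

theorem kerJ_tgt (x₁ x₂ x₃ x₄ x₅ : L.C₀) : L.tgt (L.kerJ x₁ x₂ x₃ x₄ x₅) =
    -L.br.obj x₁ x₂ (L.br.obj x₃ x₄ x₅) + L.br.obj x₃ (L.br.obj x₁ x₂ x₄) x₅
      + L.br.obj (L.br.obj x₁ x₂ x₃) x₄ x₅ + L.br.obj x₃ x₄ (L.br.obj x₁ x₂ x₅) := by
  simp only [kerJ, map_sub, L.tgt_J, L.tgt_one]
  abel

/-- Together with `map_swap`, this brings brackets with two identity entries to the normal form of
`kerBr`, with the free arrow last. -/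
theorem map_rotate (f : L.C₁) (x y : L.C₀) :
    L.br.map f (L.one x) (L.one y) = L.br.map (L.one x) (L.one y) f :=
  (L.br.map_skew.cycle _ _ _).symm

theorem map_swap (f : L.C₁) (x y : L.C₀) :
    L.br.map (L.one x) f (L.one y) = -L.br.map (L.one x) (L.one y) f :=
  L.br.map_skew.swap₂₃ _ _ _

theorem kerBr_tgt (x y : L.C₀) (f : LinearMap.ker L.src) :
    L.tgt (L.kerBr x y f) = L.br.obj x y (L.tgt f) := by
  simp only [kerBr, L.br.tgt_map, L.tgt_one]

/-- Both sides equal `[f, g, 1ₓ]`: beside an arrow of source zero, another arrow may be replaced by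
the identity of its target. This can be done for `f` as well as for `g`. -/
theorem kerBr_tgt₁ (f g : LinearMap.ker L.src) (x : L.C₀) :
    -L.kerBr (L.tgt f) x g = L.kerBr (L.tgt g) x f := Subtype.ext (by
  change -L.br.map (L.one (L.tgt f)) (L.one x) g = L.br.map (L.one (L.tgt g)) (L.one x) f
  rw [← L.map_swap, L.map_one_ker (LinearMap.mem_ker.1 g.2),
    ← L.map_ker_one (LinearMap.mem_ker.1 f.2), L.map_rotate])

/-- Naturality of `J` at `f` and four identities. Since `f` has source zero, multilinearity kills
the value of `J` at the sources, and what is left at the targets, less an identity, is `kerJ`. The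
third slot is treated the same way in `kerJ_tgt₃`. -/
theorem kerJ_tgt₁ (f : LinearMap.ker L.src) (x₂ x₃ x₄ x₅ : L.C₀) :
    L.kerJ (L.tgt f) x₂ x₃ x₄ x₅ = -L.kerBr x₂ (L.br.obj x₃ x₄ x₅) f
      + -L.kerBr x₃ x₅ (L.kerBr x₂ x₄ f) + L.kerBr x₄ x₅ (L.kerBr x₂ x₃ f)
      + L.kerBr x₃ x₄ (L.kerBr x₂ x₅ f) := by
  have n := L.J_nat f (L.one x₂) (L.one x₃) (L.one x₄) (L.one x₅)
  simp only [TwoVect.comp_eq, L.br.tgt_map, L.tgt_one, L.src_one, L.br.map_one,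
    LinearMap.mem_ker.1 f.2,
    (L.J_lin.lin₁ _ _ _ _).map_zero, map_zero, zero_add,
    sub_zero] at n
  simp only [L.map_rotate, L.map_swap] at n
  refine Subtype.ext ?_
  simp only [kerJ, kerBr, Submodule.coe_add, Submodule.coe_neg]
  linear_combination (norm := module) n

theorem kerJ_tgt₃ (f : LinearMap.ker L.src) (x₁ x₂ x₄ x₅ : L.C₀) :
    L.kerJ x₁ x₂ (L.tgt f) x₄ x₅ = -L.kerBr x₁ x₂ (L.kerBr x₄ x₅ f)
      + L.kerBr (L.br.obj x₁ x₂ x₄) x₅ f + L.kerBr x₄ x₅ (L.kerBr x₁ x₂ f)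
      + L.kerBr x₄ (L.br.obj x₁ x₂ x₅) f := by
  have n := L.J_nat (L.one x₁) (L.one x₂) f (L.one x₄) (L.one x₅)
  simp only [TwoVect.comp_eq, L.br.tgt_map, L.tgt_one, L.src_one, L.br.map_one,
    LinearMap.mem_ker.1 f.2,
    (L.J_lin.lin₃ _ _ _ _).map_zero, map_zero, zero_add,
    sub_zero] at n
  simp only [L.map_rotate] at n
  refine Subtype.ext ?_
  simp only [kerJ, kerBr, Submodule.coe_add, Submodule.coe_neg]
  linear_combination (norm := module) n

/-- Once composition is written additively, the equality of the two seven-variable composites is a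
linear relation between values of `J` and identities; subtracting the identities of the sources
turns it into (e). -/
theorem kerJ_coherence (x₁ x₂ x₃ x₄ x₅ x₆ x₇ : L.C₀) :
    L.kerBr x₆ x₇ (L.kerJ x₁ x₂ x₃ x₄ x₅) + -L.kerBr x₅ x₇ (L.kerJ x₁ x₂ x₃ x₄ x₆)
      + L.kerBr x₁ x₂ (L.kerJ x₃ x₄ x₅ x₆ x₇) + L.kerBr x₅ x₆ (L.kerJ x₁ x₂ x₃ x₄ x₇)
      + L.kerJ x₁ x₂ (L.br.obj x₃ x₄ x₅) x₆ x₇ + L.kerJ x₁ x₂ x₅ (L.br.obj x₃ x₄ x₆) x₇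
      + L.kerJ x₁ x₂ x₅ x₆ (L.br.obj x₃ x₄ x₇)
    = L.kerBr x₃ x₄ (L.kerJ x₁ x₂ x₅ x₆ x₇) + L.kerJ (L.br.obj x₁ x₂ x₃) x₄ x₅ x₆ x₇
      + L.kerJ x₃ (L.br.obj x₁ x₂ x₄) x₅ x₆ x₇ + L.kerJ x₃ x₄ (L.br.obj x₁ x₂ x₅) x₆ x₇
      + L.kerJ x₃ x₄ x₅ (L.br.obj x₁ x₂ x₆) x₇ + L.kerJ x₁ x₂ x₃ x₄ (L.br.obj x₅ x₆ x₇)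
      + L.kerJ x₃ x₄ x₅ x₆ (L.br.obj x₁ x₂ x₇) := by
  have n := L.fundamentor x₁ x₂ x₃ x₄ x₅ x₆ x₇
  have s := L.br.map_skew
  have s₀ := L.br.obj_skew
  have h := L.br.obj_lin
  simp only [TwoVect.comp_eq, ThreeLieTwoData.fundA, ThreeLieTwoData.fundB, ThreeLieTwoData.fundP,
    ThreeLieTwoData.fundQ, ThreeLieTwoData.fundR, ThreeLieTwoData.fundS, ThreeLieTwoData.fundT,
    map_add, L.br.tgt_map, L.tgt_one, L.tgt_J, h.add₃] at n
  refine Subtype.ext ?_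
  simp only [kerJ, kerBr, Submodule.coe_add, Submodule.coe_neg, L.br.map_lin.sub₃, L.br.map_one]
  -- The composites contain `J` in the first and second slots of a bracket, whereas `kerBr` keeps it
  -- last. `e₅` and `e₆` move these arrows, `o₅` and `o₆` the identities that `kerJ` subtracts from
  -- them.
  have e₆ := s.swap₂₃ (L.one x₅) (L.J x₁ x₂ x₃ x₄ x₆) (L.one x₇)
  have e₅ := s.cycle (L.J x₁ x₂ x₃ x₄ x₅) (L.one x₆) (L.one x₇)
  have o₆ := congrArg L.one (s₀.swap₂₃ x₅ (L.br.obj x₁ x₂ (L.br.obj x₃ x₄ x₆)) x₇)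
  have o₅ := congrArg L.one (s₀.cycle (L.br.obj x₁ x₂ (L.br.obj x₃ x₄ x₅)) x₆ x₇)
  rw [map_neg] at o₆
  linear_combination (norm := module) n + e₅ - e₆ - o₅ + o₆

/-- The 2-term 3-Lie-infinity-algebra of a 3-Lie 2-algebra. -/
def toTermAlg : TwoTermThreeLieInfAlg.{w, u} K where
  toTwoTermData := L.termData
  d_l₃ := L.kerBr_tgt
  l₃_d := L.kerBr_tgt₁
  d_l₅ := L.kerJ_tgt
  l₅_d₁ := L.kerJ_tgt₁
  l₅_d₃ := L.kerJ_tgt₃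
  coherence := L.kerJ_coherence

end ThreeLieTwoAlg

/-! ### The 2-functor from 2-term 3-Lie-infinity-algebras to 3-Lie 2-algebras -/

/-- The whiskering axioms of a strict 2-functor contain transports along the equations for
composites of 1-morphisms. Such transports do not alter the underlying linear map of a 2-morphism.
-/
theorem ThreeLieTwoAlg.eqToHom_comp_θ {K : Type w} [Field K] {L M : ThreeLieTwoAlg.{w, u} K}
    {F F' G G' : L ⟶ M} (h : F = F') (η : F' ⟶ G') (h' : G' = G) (x : L.C₀) :
    TwoHom.θ (eqToHom h ≫ η ≫ eqToHom h') x = TwoHom.θ η x := by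
  subst h h'
  simp only [eqToHom_refl, Category.id_comp, Category.comp_id]

theorem TwoTermThreeLieInfAlg.eqToHom_comp_τ {K : Type w} [Field K]
    {V W : TwoTermThreeLieInfAlg.{w, u} K} {φ φ' ψ ψ' : V ⟶ W} (h : φ = φ') (η : φ' ⟶ ψ')
    (h' : ψ' = ψ) (x : V.V₀) : TwoHom.τ (eqToHom h ≫ η ≫ eqToHom h') x = TwoHom.τ η x := by
  subst h h'
  simp only [eqToHom_refl, Category.id_comp, Category.comp_id]

/-- This has the shape of the 2-dimensional naturality condition of `TwoNatIso`, which it reduces to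
a comparison of underlying maps. -/
theorem ThreeLieTwoAlg.comp_eqToHom_eq {K : Type w} [Field K] {L M : ThreeLieTwoAlg.{w, u} K}
    {F F' G G' : L ⟶ M} (h : F = F') (η : F ⟶ G) (η' : F' ⟶ G') (h' : G = G')
    (e : ∀ x, TwoHom.θ η x = TwoHom.θ η' x) : η ≫ eqToHom h' = eqToHom h ≫ η' := by
  subst h h'
  simp only [eqToHom_refl, Category.id_comp, Category.comp_id]
  exact two_hom_ext e

theorem TwoTermThreeLieInfAlg.comp_eqToHom_eq {K : Type w} [Field K]
    {V W : TwoTermThreeLieInfAlg.{w, u} K} {φ φ' ψ ψ' : V ⟶ W} (h : φ = φ') (η : φ ⟶ ψ)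
    (η' : φ' ⟶ ψ') (h' : ψ = ψ') (e : ∀ x, TwoHom.τ η x = TwoHom.τ η' x) :
    η ≫ eqToHom h' = eqToHom h ≫ η' := by
  subst h h'
  simp only [eqToHom_refl, Category.id_comp, Category.comp_id]
  exact two_hom_ext e

/-! ### Homomorphisms and 2-homomorphisms induced on arrows. -/

namespace TwoTermThreeLieInfAlg

variable {K : Type w} [Field K] {V W X : TwoTermThreeLieInfAlg.{w, u} K}

namespace Hom

variable (φ : Hom V W)

/-- The action of a chain map on arrows. -/
def arrowMap : V.V₀ × V.V₁ →ₗ[K] W.V₀ × W.V₁ := LinearMap.prodMap φ.φ₀ φ.φ₁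

theorem arrowTgt_arrowMap (p : V.V₀ × V.V₁) :
    W.arrowTgt (φ.arrowMap p) = φ.φ₀ (V.arrowTgt p) :=
  (congrArg _ (φ.chain p.2)).trans (map_add φ.φ₀ _ _).symm

/-- The linear functor induced by a chain map. -/
def linFunctor : V.twoVect.LinFunctor W.twoVect where
  obj := φ.φ₀
  map := φ.arrowMap
  src_map _ := rfl
  tgt_map := φ.arrowTgt_arrowMap
  map_one _ := Prod.ext rfl (map_zero φ.φ₁)
  map_comp f g _ := Prod.ext rfl (map_add φ.φ₁ f.2 g.2)

/-- The arrow `(l₃(φ₀ x, φ₀ y, φ₀ z), φ₂(x, y, z))`. -/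
def arrow₂ (x y z : V.V₀) : W.V₀ × W.V₁ := (W.l₃ (φ.φ₀ x) (φ.φ₀ y) (φ.φ₀ z), φ.φ₂ x y z)

theorem arrow₂_lin : IsTrilinear K φ.arrow₂ := by
  have h := W.l₃_lin
  have h' := φ.φ₂_lin
  constructor <;> intros <;> constructor <;> intros <;> ext <;>
    simp only [arrow₂, Prod.fst_add, Prod.snd_add, Prod.smul_fst, Prod.smul_snd, map_add,
      map_smul, h.add₁, h.add₂, h.add₃, h.smul₁, h.smul₂, h.smul₃, h'.add₁, h'.add₂, h'.add₃,
      h'.smul₁, h'.smul₂, h'.smul₃]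

theorem arrow₂_skew : IsSkew₃ φ.arrow₂ where
  swap₁₂ _ _ _ := Prod.ext (W.l₃_skew.swap₁₂ _ _ _) (φ.φ₂_skew.swap₁₂ _ _ _)
  swap₂₃ _ _ _ := Prod.ext (W.l₃_skew.swap₂₃ _ _ _) (φ.φ₂_skew.swap₂₃ _ _ _)

theorem arrowTgt_arrow₂ (x y z : V.V₀) : W.arrowTgt (φ.arrow₂ x y z) = φ.φ₀ (V.l₃ x y z) := by
  simp only [arrow₂, arrowTgt_apply, φ.d_φ₂]
  abel

/-- The same telescoping as in `brArrow`: passing from sources to targets one slot at a time, the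
increment of `φ₂` is a sum of three values with a boundary in one slot, and `φ₂_d` evaluates each of
them. -/
theorem brArrow_nat (p q r : V.V₀ × V.V₁) :
    W.brArrow (φ.arrowMap p) (φ.arrowMap q) (φ.arrowMap r)
        + φ.φ₂ (V.arrowTgt p) (V.arrowTgt q) (V.arrowTgt r) =
      φ.φ₂ p.1 q.1 r.1 + φ.φ₁ (V.brArrow p q r) := by
  have h := φ.φ₂_lin
  have a₁ := h.add₁ q.1 r.1 p.1 (V.d p.2)
  have a₂ := h.add₂ (p.1 + V.d p.2) r.1 q.1 (V.d q.2)
  have a₃ := h.add₃ (p.1 + V.d p.2) (q.1 + V.d q.2) r.1 (V.d r.2)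
  have e₁ := φ.φ₂_d q.1 r.1 p.2
  have e₂ := φ.φ₂_d (p.1 + V.d p.2) r.1 q.2
  have e₃ := φ.φ₂_d (p.1 + V.d p.2) (q.1 + V.d q.2) r.2
  have s₁ := φ.φ₂_skew.cycle (V.d p.2) q.1 r.1
  have s₂ := φ.φ₂_skew.swap₂₃ (p.1 + V.d p.2) (V.d q.2) r.1
  simp only [brArrow, arrowMap, LinearMap.prodMap_apply, arrowTgt_apply, φ.chain,
    ← map_add φ.φ₀, map_add φ.φ₁, map_sub φ.φ₁]
  linear_combination (norm := module) a₁ + a₂ + a₃ + e₁ - e₂ + e₃ - s₁ + s₂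

theorem brArrow_coherence (x₁ x₂ x₃ x₄ x₅ : V.V₀) :
    W.brArrow (φ.φ₀ x₁, 0) (φ.φ₀ x₂, 0) (φ.arrow₂ x₃ x₄ x₅)
      + (φ.φ₂ x₁ x₂ (V.l₃ x₃ x₄ x₅) + φ.φ₁ (V.l₅ x₁ x₂ x₃ x₄ x₅))
    = W.l₅ (φ.φ₀ x₁) (φ.φ₀ x₂) (φ.φ₀ x₃) (φ.φ₀ x₄) (φ.φ₀ x₅)
      + ((W.brArrow (φ.arrow₂ x₁ x₂ x₃) (φ.φ₀ x₄, 0) (φ.φ₀ x₅, 0)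
          + W.brArrow (φ.φ₀ x₃, 0) (φ.arrow₂ x₁ x₂ x₄) (φ.φ₀ x₅, 0)
          + W.brArrow (φ.φ₀ x₃, 0) (φ.φ₀ x₄, 0) (φ.arrow₂ x₁ x₂ x₅))
        + (φ.φ₂ (V.l₃ x₁ x₂ x₃) x₄ x₅ + φ.φ₂ x₃ (V.l₃ x₁ x₂ x₄) x₅
          + φ.φ₂ x₃ x₄ (V.l₃ x₁ x₂ x₅))) := by
  have h := W.l₃'_lin
  have e := φ.coherence x₁ x₂ x₃ x₄ x₅
  simp only [arrow₂, brArrow, map_zero, add_zero, h.zero₃, sub_zero, zero_sub, zero_add,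
    TwoTermData.l₃₁₀₀, TwoTermData.l₃₀₁₀] at e ⊢
  linear_combination (norm := module) -e

/-- The homomorphism of 3-Lie 2-algebras induced by a homomorphism of 2-term
3-Lie-infinity-algebras. -/
def toTwoAlg : ThreeLieTwoAlg.Hom V.toTwoAlg W.toTwoAlg where
  toLinFunctor := φ.linFunctor
  F₂ := φ.arrow₂
  F₂_lin := φ.arrow₂_lin
  F₂_skew := φ.arrow₂_skew
  src_F₂ _ _ _ := rfl
  tgt_F₂ := φ.arrowTgt_arrow₂
  F₂_nat p q r := Prod.ext rfl (φ.brArrow_nat p q r)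
  coherence x₁ x₂ x₃ x₄ x₅ := Prod.ext rfl (φ.brArrow_coherence x₁ x₂ x₃ x₄ x₅)

end Hom

namespace TwoHom

variable {φ ψ : Hom V W} (σ : TwoHom φ ψ)

/-- Expanded over sources, the bracket of the arrows `(φ₀ x, τ x)` has seven terms, which are those
of the cyclic formula for a 2-homomorphism. The match takes two exchanges of arguments and one use
of (b). -/
theorem brArrow_coherence (x y z : V.V₀) :
    φ.φ₂ x y z + σ.τ (V.l₃ x y z) =
      W.brArrow (φ.φ₀ x, σ.τ x) (φ.φ₀ y, σ.τ y) (φ.φ₀ z, σ.τ z) + ψ.φ₂ x y z := by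
  have h := W.l₃'_lin
  have e := σ.coherence x y z
  simp only [brArrow, TwoTermData.l₃₀₁₀, h.add₁, h.add₂] at e ⊢
  linear_combination (norm := module) e + W.l₃'_skew (φ.φ₀ x) (φ.φ₀ z) (σ.τ y)
    - W.l₃'_skew (W.d (σ.τ y)) (φ.φ₀ x) (σ.τ z)
    - W.l₃'_d₁ (σ.τ x) (σ.τ z) (φ.φ₀ y)

/-- The 2-homomorphism `x ↦ (φ₀ x, τ x)` of 3-Lie 2-algebras. -/
def toTwoAlg : ThreeLieTwoAlg.TwoHom φ.toTwoAlg ψ.toTwoAlg where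
  θ := LinearMap.prod φ.φ₀ σ.τ
  src_θ _ := rfl
  tgt_θ x := (congrArg _ (σ.d_τ x)).trans (add_sub_cancel _ _)
  nat f := Prod.ext rfl (by
    have e := σ.τ_d f.2
    change φ.φ₁ f.2 + σ.τ (f.1 + V.d f.2) = σ.τ f.1 + ψ.φ₁ f.2
    rw [map_add, e]; abel)
  coherence x y z := Prod.ext rfl (σ.brArrow_coherence x y z)

end TwoHom

variable (K) in
/-- The strict 2-functor from 2-term 3-Lie-infinity-algebras to 3-Lie 2-algebras. -/
def toTwoAlgFunctor :
    StrictPseudofunctor (TwoTermThreeLieInfAlg.{w, u} K) (ThreeLieTwoAlg.{w, u} K) :=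
  StrictPseudofunctor.mk''
    { obj := toTwoAlg
      map := Hom.toTwoAlg
      map₂ := TwoHom.toTwoAlg
      map₂_id := fun _ => rfl
      map₂_comp := fun _ _ => ThreeLieTwoAlg.two_hom_ext fun _ =>
        Prod.ext rfl (add_comm _ _)
      map_id := fun _ => ThreeLieTwoAlg.Hom.ext' rfl rfl rfl
      map_comp := fun _ _ => ThreeLieTwoAlg.Hom.ext' rfl rfl rfl
      map₂_whisker_left := fun _ _ _ _ => ThreeLieTwoAlg.two_hom_ext fun x =>
        (ThreeLieTwoAlg.eqToHom_comp_θ _ _ _ x).symm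
      map₂_whisker_right := fun _ _ => ThreeLieTwoAlg.two_hom_ext fun x =>
        (ThreeLieTwoAlg.eqToHom_comp_θ _ _ _ x).symm }

end TwoTermThreeLieInfAlg

/-! ### The 2-functor from 3-Lie 2-algebras to 2-term 3-Lie-infinity-algebras -/

namespace ThreeLieTwoAlg

variable {K : Type w} [Field K] {L M N : ThreeLieTwoAlg.{w, u} K}

/-- Every bracket functor is given on arrows by the formula of `brArrow`, hence is determined by its
values on objects and by `kerBr`. Of the eight terms of the trilinear expansion, those with several
arrows of source zero reduce to `kerBr` by `map_one_ker`. -/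
theorem br_add_ker (x y z : L.C₀) (f g h : LinearMap.ker L.src) :
    L.br.map (L.one x + f) (L.one y + g) (L.one z + h) =
      L.one (L.br.obj x y z) + (L.kerBr y z f - L.kerBr (x + L.tgt f) z g
        + L.kerBr (x + L.tgt f) (y + L.tgt g) h : LinearMap.ker L.src) := by
  have a := L.br.map_lin
  have s := L.br.map_skew
  have hg := LinearMap.mem_ker.1 g.2
  have hh := LinearMap.mem_ker.1 h.2
  -- Permuted forms of `map_one_ker`: as `h` has source zero, `f` and `g` may be exchanged with the
  -- identities of their targets, whatever the remaining entry is.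
  have e₁₃ : ∀ k, L.br.map (L.one (L.tgt f)) k h = L.br.map f k h := fun k => by
    rw [s.swap₂₃ _ h, L.map_one_ker hh, s.swap₂₃ _ h]
  have e₂₃ : ∀ k, L.br.map k (L.one (L.tgt g)) h = L.br.map k g h := fun k => by
    rw [← s.cycle, L.map_one_ker hh, s.cycle]
  simp only [kerBr, Submodule.coe_add, Submodule.coe_sub, map_add, a.add₁, a.add₂, a.add₃,
    L.br.map_one, e₁₃, e₂₃]
  simp only [L.map_rotate f, L.map_swap g]
  linear_combination (norm := module) L.map_swap g (L.tgt f) z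
    - L.map_one_ker (f := (f : L.C₁)) hg (L.one z)

namespace Hom

variable (F : Hom L M)

/-- The restriction of a functor to the arrows of source zero. -/
def kerMap : LinearMap.ker L.src →ₗ[K] LinearMap.ker M.src :=
  F.map.restrict fun f hf => by
    rw [LinearMap.mem_ker, F.src_map, LinearMap.mem_ker.1 hf, map_zero]

/-- The part of `F₂` with source zero. -/
def kerF₂ (x y z : L.C₀) : LinearMap.ker M.src :=
  ⟨F.F₂ x y z - M.one (M.br.obj (F.obj x) (F.obj y) (F.obj z)), by
    rw [LinearMap.mem_ker, map_sub, F.src_F₂, M.src_one, sub_self]⟩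

theorem kerF₂_lin : IsTrilinear K F.kerF₂ := by
  have h := M.br.obj_lin
  have h' := F.F₂_lin
  constructor <;> intros <;> constructor <;> intros <;> refine Subtype.ext ?_ <;>
    simp only [kerF₂, map_add, map_smul, Submodule.coe_add, Submodule.coe_smul, h.add₁, h.add₂,
      h.add₃, h.smul₁, h.smul₂, h.smul₃, h'.add₁, h'.add₂, h'.add₃, h'.smul₁, h'.smul₂,
      h'.smul₃] <;> module

theorem kerF₂_skew : IsSkew₃ F.kerF₂ := by
  constructor <;> intro x y z <;> refine Subtype.ext ?_ <;> simp only [kerF₂, Submodule.coe_neg]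
  · rw [F.F₂_skew.swap₁₂, M.br.obj_skew.swap₁₂ (F.obj x), map_neg]; abel
  · rw [F.F₂_skew.swap₂₃, M.br.obj_skew.swap₂₃ _ (F.obj y), map_neg]; abel

theorem kerF₂_tgt (x y z : L.C₀) : M.tgt (F.kerF₂ x y z) =
    F.obj (L.br.obj x y z) - M.br.obj (F.obj x) (F.obj y) (F.obj z) := by
  simp only [kerF₂, map_sub, F.tgt_F₂, M.tgt_one]

/-- Naturality of `F₂` at two identities and `h`; the value of `F₂` at the sources vanishes because
`h` has source zero. -/
theorem kerF₂_apply_tgt (x y : L.C₀) (h : LinearMap.ker L.src) : F.kerF₂ x y (L.tgt h) =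
    F.kerMap (L.kerBr x y h) - M.kerBr (F.obj x) (F.obj y) (F.kerMap h) := by
  have n := F.F₂_nat (L.one x) (L.one y) h
  simp only [TwoVect.comp_eq, M.br.tgt_map, L.tgt_one, M.tgt_one, F.map_one, L.src_one, F.tgt_map,
    LinearMap.mem_ker.1 h.2, F.F₂_lin.zero₃, map_zero, zero_add,
    sub_zero] at n
  refine Subtype.ext ?_
  simp only [kerF₂, kerMap, kerBr, Submodule.coe_sub, LinearMap.coe_restrict_apply]
  linear_combination (norm := module) n

theorem kerF₂_coherence (x₁ x₂ x₃ x₄ x₅ : L.C₀) :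
    M.kerJ (F.obj x₁) (F.obj x₂) (F.obj x₃) (F.obj x₄) (F.obj x₅)
      + M.kerBr (F.obj x₄) (F.obj x₅) (F.kerF₂ x₁ x₂ x₃)
      + -M.kerBr (F.obj x₃) (F.obj x₅) (F.kerF₂ x₁ x₂ x₄)
      + M.kerBr (F.obj x₃) (F.obj x₄) (F.kerF₂ x₁ x₂ x₅)
      + F.kerF₂ (L.br.obj x₁ x₂ x₃) x₄ x₅ + F.kerF₂ x₃ (L.br.obj x₁ x₂ x₄) x₅
      + F.kerF₂ x₃ x₄ (L.br.obj x₁ x₂ x₅)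
    = M.kerBr (F.obj x₁) (F.obj x₂) (F.kerF₂ x₃ x₄ x₅) + F.kerF₂ x₁ x₂ (L.br.obj x₃ x₄ x₅)
      + F.kerMap (L.kerJ x₁ x₂ x₃ x₄ x₅) := by
  have n := F.coherence x₁ x₂ x₃ x₄ x₅
  simp only [TwoVect.comp_eq, HomData.pathA, HomData.pathB, HomData.pathC, map_add, M.br.tgt_map,
    M.tgt_one, F.tgt_F₂, M.tgt_J] at n
  -- In `[F₂, 1, 1]` and `[1, F₂, 1]` the free arrow is moved to the last slot. `o₃` and `o₄` do the
  -- same for the identities that `kerF₂` subtracts.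
  have o₄ := congrArg M.one (M.br.obj_skew.swap₂₃ (F.obj x₃)
    (M.br.obj (F.obj x₁) (F.obj x₂) (F.obj x₄)) (F.obj x₅))
  have o₃ := congrArg M.one (M.br.obj_skew.cycle
    (M.br.obj (F.obj x₁) (F.obj x₂) (F.obj x₃)) (F.obj x₄) (F.obj x₅))
  rw [map_neg] at o₄
  refine Subtype.ext ?_
  simp only [kerF₂, kerMap, kerBr, kerJ, Submodule.coe_add, Submodule.coe_neg,
    LinearMap.coe_restrict_apply, M.br.map_lin.sub₃, M.br.map_one, map_sub, F.map_one]
  rw [M.map_rotate (F.F₂ x₁ x₂ x₃), M.map_swap (F.F₂ x₁ x₂ x₄)] at n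
  linear_combination (norm := module) -n + o₄ - o₃

/-- The homomorphism of 2-term 3-Lie-infinity-algebras induced by a homomorphism of 3-Lie
2-algebras. -/
def toTermAlg : TwoTermThreeLieInfAlg.Hom L.toTermAlg M.toTermAlg where
  φ₀ := F.obj
  φ₁ := F.kerMap
  φ₂ := F.kerF₂
  chain _ := F.tgt_map _
  φ₂_lin := F.kerF₂_lin
  φ₂_skew := F.kerF₂_skew
  d_φ₂ := F.kerF₂_tgt
  φ₂_d := F.kerF₂_apply_tgt
  coherence := F.kerF₂_coherence

end Hom

namespace TwoHom

variable {F G : Hom L M} (σ : TwoHom F G)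

/-- The part of a natural transformation with source zero. -/
def kerθ : L.C₀ →ₗ[K] LinearMap.ker M.src :=
  (σ.θ - M.one ∘ₗ F.obj).codRestrict _ fun x => by
    rw [LinearMap.mem_ker, LinearMap.sub_apply, map_sub, σ.src_θ, LinearMap.comp_apply, M.src_one,
      sub_self]

theorem kerθ_coe (x : L.C₀) : (σ.kerθ x : M.C₁) = σ.θ x - M.one (F.obj x) := rfl

theorem kerθ_tgt (x : L.C₀) : M.tgt (σ.kerθ x) = G.obj x - F.obj x := by
  rw [kerθ_coe, map_sub, σ.tgt_θ, M.tgt_one]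

theorem kerθ_apply_tgt (f : LinearMap.ker L.src) :
    σ.kerθ (L.tgt f) = G.kerMap f - F.kerMap f := by
  have n := σ.nat f
  simp only [TwoVect.comp_eq, LinearMap.mem_ker.1 f.2, map_zero, F.tgt_map, zero_add,
    sub_zero] at n
  refine Subtype.ext ?_
  simp only [kerθ_coe, Hom.kerMap, Submodule.coe_sub, LinearMap.coe_restrict_apply]
  linear_combination (norm := module) n

/-- Writing each `θ x` as an identity plus `kerθ x`, `br_add_ker` expands the bracket of the three
arrows in the compatibility condition of `θ`. -/
theorem kerθ_coherence (x₁ x₂ x₃ : L.C₀) : F.kerF₂ x₁ x₂ x₃ - G.kerF₂ x₁ x₂ x₃ =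
    (M.kerBr (F.obj x₁) (F.obj x₂) (σ.kerθ x₃) + M.kerBr (F.obj x₂) (F.obj x₃) (σ.kerθ x₁)
      + M.kerBr (F.obj x₃) (F.obj x₁) (σ.kerθ x₂))
    + (-M.kerBr (M.tgt (σ.kerθ x₁)) (F.obj x₃) (σ.kerθ x₂)
      + -M.kerBr (M.tgt (σ.kerθ x₂)) (F.obj x₁) (σ.kerθ x₃)
      + -M.kerBr (M.tgt (σ.kerθ x₃)) (F.obj x₂) (σ.kerθ x₁))
    - σ.kerθ (L.br.obj x₁ x₂ x₃)
    + M.kerBr (M.tgt (σ.kerθ x₁)) (M.tgt (σ.kerθ x₂)) (σ.kerθ x₃) := by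
  have n := σ.coherence x₁ x₂ x₃
  have e := br_add_ker (F.obj x₁) (F.obj x₂) (F.obj x₃) (σ.kerθ x₁) (σ.kerθ x₂) (σ.kerθ x₃)
  have t := M.kerBr_tgt₁ (σ.kerθ x₁) (σ.kerθ x₃) (F.obj x₂)
  have s : ∀ x y f, M.kerBr y x f = -M.kerBr x y f := M.toTermAlg.l₃'_skew
  have s₁ := s (F.obj x₁) (F.obj x₃) (σ.kerθ x₂)
  have s₂ := s (M.tgt (σ.kerθ x₂)) (F.obj x₁) (σ.kerθ x₃)
  have h := M.kerBr_lin
  have hθ : ∀ x, M.one (F.obj x) + (σ.kerθ x : M.C₁) = σ.θ x := fun x => add_sub_cancel _ _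
  simp only [TwoVect.comp_eq, F.tgt_F₂, M.br.tgt_map, σ.tgt_θ] at n
  rw [hθ, hθ, hθ] at e
  -- This is the asymmetric form, in which the slots move to their targets one after another. The
  -- cyclic form follows by the exchanges `s₁` and `s₂` and by `t`, an instance of (b).
  have r : F.kerF₂ x₁ x₂ x₃ - G.kerF₂ x₁ x₂ x₃ + σ.kerθ (L.br.obj x₁ x₂ x₃) =
      M.kerBr (F.obj x₂) (F.obj x₃) (σ.kerθ x₁)
        - M.kerBr (F.obj x₁ + M.tgt (σ.kerθ x₁)) (F.obj x₃) (σ.kerθ x₂)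
        + M.kerBr (F.obj x₁ + M.tgt (σ.kerθ x₁)) (F.obj x₂ + M.tgt (σ.kerθ x₂)) (σ.kerθ x₃) :=
    Subtype.ext (by
      simp only [Submodule.coe_add, Submodule.coe_sub, Hom.kerF₂, kerθ_coe] at e ⊢
      linear_combination (norm := module) n + e)
  simp only [h.add₁, h.add₂] at r
  linear_combination (norm := module) r - s₁ + s₂ - t

/-- The 2-homomorphism of 2-term 3-Lie-infinity-algebras induced by a 2-homomorphism of 3-Lie
2-algebras. -/
def toTermAlg : TwoTermThreeLieInfAlg.TwoHom F.toTermAlg G.toTermAlg where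
  τ := σ.kerθ
  d_τ := σ.kerθ_tgt
  τ_d := σ.kerθ_apply_tgt
  coherence := σ.kerθ_coherence

end TwoHom

/-- The identity of the middle object, subtracted when composing `G₂` with the image of `F₂`, is the
image under `G` of the identity subtracted in `F.kerF₂`. Composition is therefore preserved exactly.
-/
theorem kerF₂_comp (F : Hom L M) (G : Hom M N) (x y z : L.C₀) : (F.comp G).kerF₂ x y z =
    G.kerF₂ (F.obj x) (F.obj y) (F.obj z) + G.kerMap (F.kerF₂ x y z) := Subtype.ext (by
  change compF₂ F G x y z - N.one (N.br.obj (G.obj (F.obj x)) (G.obj (F.obj y)) (G.obj (F.obj z))) =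
    G.F₂ (F.obj x) (F.obj y) (F.obj z)
      - N.one (N.br.obj (G.obj (F.obj x)) (G.obj (F.obj y)) (G.obj (F.obj z)))
      + G.map (F.F₂ x y z - M.one (M.br.obj (F.obj x) (F.obj y) (F.obj z)))
  rw [compF₂_eq, map_sub, G.map_one]
  abel)

theorem Hom.toTermAlg_comp (F : Hom L M) (G : Hom M N) :
    (F.comp G).toTermAlg = F.toTermAlg.comp G.toTermAlg :=
  TwoTermThreeLieInfAlg.Hom.ext rfl rfl
    (funext fun x => funext fun y => funext fun z => kerF₂_comp F G x y z)

theorem kerθ_whiskerLeft (F : Hom L M) {G G' : Hom M N} (σ : TwoHom G G') (x : L.C₀) :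
    (TwoHom.whiskerLeft F σ).kerθ x = σ.kerθ (F.obj x) := rfl

theorem kerθ_whiskerRight {F F' : Hom L M} (σ : TwoHom F F') (G : Hom M N) (x : L.C₀) :
    (TwoHom.whiskerRight σ G).kerθ x = G.kerMap (σ.kerθ x) := Subtype.ext (by
  change G.map (σ.θ x) - N.one (G.obj (F.obj x)) = G.map (σ.θ x - M.one (F.obj x))
  rw [map_sub, G.map_one])

variable (K) in
/-- The strict 2-functor from 3-Lie 2-algebras to 2-term 3-Lie-infinity-algebras. -/
def toTermAlgFunctor :
    StrictPseudofunctor (ThreeLieTwoAlg.{w, u} K) (TwoTermThreeLieInfAlg.{w, u} K) :=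
  StrictPseudofunctor.mk''
    { obj := toTermAlg
      map := Hom.toTermAlg
      map₂ := TwoHom.toTermAlg
      map₂_id := fun {L M} F => TwoTermThreeLieInfAlg.two_hom_ext fun x =>
        Subtype.ext (sub_self (M.one (F.obj x)))
      map₂_comp := fun {L M F G H} σ ρ => TwoTermThreeLieInfAlg.two_hom_ext fun x =>
        Subtype.ext (by
          have e := comp_θ σ ρ x
          change TwoHom.θ (σ ≫ ρ) x - M.one (F.obj x) =
            (ρ.θ x - M.one (G.obj x)) + (σ.θ x - M.one (F.obj x))
          rw [e]; abel)
      map_id := fun L => TwoTermThreeLieInfAlg.Hom.ext rfl rfl (by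
        funext x y z
        exact Subtype.ext (sub_self (L.one (L.br.obj x y z))))
      map_comp := Hom.toTermAlg_comp
      map₂_whisker_left := fun F _ _ σ => TwoTermThreeLieInfAlg.two_hom_ext fun x =>
        (kerθ_whiskerLeft F σ x).trans (TwoTermThreeLieInfAlg.eqToHom_comp_τ _
          (TwoTermThreeLieInfAlg.TwoHom.whiskerLeft F.toTermAlg σ.toTermAlg) _ x).symm
      map₂_whisker_right := fun σ G => TwoTermThreeLieInfAlg.two_hom_ext fun x =>
        (kerθ_whiskerRight σ G x).trans (TwoTermThreeLieInfAlg.eqToHom_comp_τ _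
          (TwoTermThreeLieInfAlg.TwoHom.whiskerRight σ.toTermAlg G.toTermAlg) _ x).symm }

end ThreeLieTwoAlg

/-! ### The unit -/

namespace TwoTermThreeLieInfAlg

variable {K : Type w} [Field K] (V : TwoTermThreeLieInfAlg.{w, u} K)
  {W : TwoTermThreeLieInfAlg.{w, u} K}

theorem brArrow_one_one (x y : V.V₀) (p : V.V₀ × V.V₁) :
    V.brArrow (x, 0) (y, 0) p = V.l₃' x y p.2 := by
  simp only [brArrow, map_zero, add_zero, V.l₃'_lin.zero₃, sub_zero, zero_add]

theorem isTrilinear_zero {A B C D : Type u} [AddCommGroup A] [Module K A] [AddCommGroup B]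
    [Module K B] [AddCommGroup C] [Module K C] [AddCommGroup D] [Module K D] :
    IsTrilinear K fun (_ : A) (_ : B) (_ : C) => (0 : D) := by
  constructor <;> intros <;> constructor <;> simp

theorem isSkew₃_zero {A D : Type u} [AddCommGroup D] : IsSkew₃ fun _ _ _ : A => (0 : D) where
  swap₁₂ _ _ _ := neg_zero.symm
  swap₂₃ _ _ _ := neg_zero.symm

/-- A homomorphism with `φ₂ = 0`, given by a chain map that preserves `l₃` and `l₅`. -/
def Hom.ofStrict {V W : TwoTermThreeLieInfAlg.{w, u} K} (φ₀ : V.V₀ →ₗ[K] W.V₀)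
    (φ₁ : V.V₁ →ₗ[K] W.V₁) (chain : ∀ f, W.d (φ₁ f) = φ₀ (V.d f))
    (h₃ : ∀ x y z, φ₀ (V.l₃ x y z) = W.l₃ (φ₀ x) (φ₀ y) (φ₀ z))
    (h₃' : ∀ x y f, φ₁ (V.l₃' x y f) = W.l₃' (φ₀ x) (φ₀ y) (φ₁ f))
    (h₅ : ∀ a b c d e, φ₁ (V.l₅ a b c d e) = W.l₅ (φ₀ a) (φ₀ b) (φ₀ c) (φ₀ d) (φ₀ e)) :
    Hom V W where
  φ₀ := φ₀
  φ₁ := φ₁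
  φ₂ _ _ _ := 0
  chain := chain
  φ₂_lin := isTrilinear_zero
  φ₂_skew := isSkew₃_zero
  d_φ₂ x y z := by rw [map_zero, h₃, sub_self]
  φ₂_d x y f := by rw [h₃', sub_self]
  coherence a b c d e := by
    simp only [h₅, TwoTermData.l₃₁₀₀, TwoTermData.l₃₀₁₀, W.l₃'_lin.zero₃, neg_zero, add_zero,
      zero_add]

/-- The projection from the arrows of source zero to `V₁`. -/
def kerSnd : V.toTwoAlg.toTermAlg.V₁ →ₗ[K] V.V₁ :=
  LinearMap.snd K V.V₀ V.V₁ ∘ₗ (LinearMap.ker (LinearMap.fst K V.V₀ V.V₁)).subtype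

/-- The inclusion of `V₁` as the arrows of source zero. -/
def kerInr : V.V₁ →ₗ[K] V.toTwoAlg.toTermAlg.V₁ :=
  (LinearMap.inr K V.V₀ V.V₁).codRestrict (LinearMap.ker (LinearMap.fst K V.V₀ V.V₁)) fun _ => rfl

theorem kerSnd_kerInr (f : V.V₁) : V.kerSnd (V.kerInr f) = f := rfl

theorem kerInr_kerSnd (f : V.toTwoAlg.toTermAlg.V₁) : V.kerInr (V.kerSnd f) = f :=
  Subtype.ext (Prod.ext (LinearMap.mem_ker.1 f.2).symm rfl)

theorem d_kerSnd (f : V.toTwoAlg.toTermAlg.V₁) :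
    V.d (V.kerSnd f) = V.toTwoAlg.toTermAlg.d f := by
  obtain ⟨⟨x, f⟩, hx⟩ := f
  obtain rfl : x = 0 := hx
  exact (zero_add _).symm

theorem kerSnd_l₃' (x y : V.V₀) (f : V.toTwoAlg.toTermAlg.V₁) :
    V.kerSnd (V.toTwoAlg.toTermAlg.l₃' x y f) = V.l₃' x y (V.kerSnd f) :=
  V.brArrow_one_one x y _

theorem kerSnd_l₅ (a b c d e : V.V₀) :
    V.kerSnd (V.toTwoAlg.toTermAlg.l₅ a b c d e) = V.l₅ a b c d e := sub_zero _

/-- The component of the unit at `V`. -/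
def unitHom : Hom V.toTwoAlg.toTermAlg V :=
  Hom.ofStrict LinearMap.id V.kerSnd V.d_kerSnd (fun _ _ _ => rfl) V.kerSnd_l₃' V.kerSnd_l₅

/-- The inverse of the component of the unit at `V`. -/
def unitInv : Hom V V.toTwoAlg.toTermAlg :=
  Hom.ofStrict LinearMap.id V.kerInr
    (fun f => (V.d_kerSnd _).symm) (fun _ _ _ => rfl)
    (fun x y f => by
      rw [← V.kerInr_kerSnd (V.toTwoAlg.toTermAlg.l₃' _ _ _)]
      exact (congrArg V.kerInr (V.kerSnd_l₃' x y (V.kerInr f))).symm)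
    (fun a b c d e => by
      rw [← V.kerInr_kerSnd (V.toTwoAlg.toTermAlg.l₅ _ _ _ _ _)]
      exact (congrArg V.kerInr (V.kerSnd_l₅ a b c d e)).symm)

theorem unitHom_comp_unitInv : V.unitHom.comp V.unitInv = Hom.id _ :=
  Hom.ext rfl (LinearMap.ext V.kerInr_kerSnd) (by
    funext x y z
    exact (zero_add _).trans (map_zero _))

theorem unitInv_comp_unitHom : V.unitInv.comp V.unitHom = Hom.id _ :=
  Hom.ext rfl (LinearMap.ext V.kerSnd_kerInr) (by
    funext x y z
    exact (zero_add _).trans (map_zero _))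

variable {V}

/-- The unit components have `φ₂ = 0`, and taking the part of source zero of the arrow `arrow₂`
recovers `φ₂`; so both composites have the `φ₂` of `φ`. -/
theorem unitHom_naturality (φ : Hom V W) :
    φ.toTwoAlg.toTermAlg.comp W.unitHom = V.unitHom.comp φ :=
  Hom.ext rfl rfl (by
    funext x y z
    change 0 + (φ.φ₂ x y z - 0) = φ.φ₂ x y z + φ.φ₁ 0
    rw [map_zero, zero_add, sub_zero, add_zero])

variable (K) in
/-- The unit of the 2-equivalence. -/
def unitIso : TwoNatIso
    (StrictPseudofunctor.comp (toTwoAlgFunctor.{w, u} K) (ThreeLieTwoAlg.toTermAlgFunctor.{w, u} K))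
    (StrictPseudofunctor.id (TwoTermThreeLieInfAlg.{w, u} K)) where
  hom := unitHom
  inv := unitInv
  hom_inv := unitHom_comp_unitInv
  inv_hom := unitInv_comp_unitHom
  naturality := unitHom_naturality
  -- The kernel part of `(φ₀ x, τ x)` is obtained by subtracting the identity `(φ₀ x, 0)`, which
  -- leaves `τ x`.
  naturality₂ σ := comp_eqToHom_eq _ _ _ _ fun x => sub_zero (TwoHom.τ σ x)

end TwoTermThreeLieInfAlg

/-! ### The counit -/

namespace ThreeLieTwoAlg

variable {K : Type w} [Field K] {L M N : ThreeLieTwoAlg.{w, u} K}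

/-- The homomorphism with identity natural transformation, given by a linear functor that preserves
the brackets and the Jacobiators. -/
def Hom.ofStrict (T : L.toTwoVect.LinFunctor M.toTwoVect)
    (h₀ : ∀ x y z, T.obj (L.br.obj x y z) = M.br.obj (T.obj x) (T.obj y) (T.obj z))
    (h₁ : ∀ f g h, T.map (L.br.map f g h) = M.br.map (T.map f) (T.map g) (T.map h))
    (hJ : ∀ a b c d e, T.map (L.J a b c d e) =
      M.J (T.obj a) (T.obj b) (T.obj c) (T.obj d) (T.obj e)) : Hom L M where
  toLinFunctor := T
  F₂ x y z := M.one (M.br.obj (T.obj x) (T.obj y) (T.obj z))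
  F₂_lin := by
    have h := M.br.obj_lin
    constructor <;> intros <;> constructor <;> intros <;>
      simp only [map_add, map_smul, h.add₁, h.add₂, h.add₃, h.smul₁, h.smul₂, h.smul₃]
  F₂_skew := by
    constructor <;> intro x y z
    · rw [M.br.obj_skew.swap₁₂ (T.obj x), map_neg]
    · rw [M.br.obj_skew.swap₂₃ _ (T.obj y), map_neg]
  src_F₂ _ _ _ := M.src_one _
  tgt_F₂ x y z := (M.tgt_one _).trans (h₀ x y z).symm
  F₂_nat f g h := by
    simp only [TwoVect.comp_eq, h₁, M.br.tgt_map, M.tgt_one, T.tgt_map]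
    abel
  coherence a b c d e := by
    simp only [TwoVect.comp_eq, HomData.pathA, HomData.pathB, HomData.pathC, hJ, h₀, M.br.map_one,
      map_add, M.tgt_one, M.tgt_J]
    abel

/-- The strict factor contributes an identity arrow, which disappears in the composite. -/
theorem Hom.ofStrict_comp_F₂ (F : Hom L M) (T : M.toTwoVect.LinFunctor N.toTwoVect) (h₀ h₁ hJ)
    (x y z : L.C₀) : (F.comp (Hom.ofStrict T h₀ h₁ hJ)).F₂ x y z = T.map (F.F₂ x y z) := by
  refine (compF₂_eq F (Hom.ofStrict T h₀ h₁ hJ) x y z).trans ?_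
  change N.one (N.br.obj (T.obj (F.obj x)) (T.obj (F.obj y)) (T.obj (F.obj z)))
    + T.map (F.F₂ x y z) - N.one (T.obj (M.br.obj (F.obj x) (F.obj y) (F.obj z))) = _
  rw [h₀, add_sub_cancel_left]

variable (L)

/-- The inclusion of the arrows of source zero into all arrows. -/
def kerVal : L.toTermAlg.V₁ →ₗ[K] L.C₁ := (LinearMap.ker L.src).subtype

theorem src_kerVal (f : L.toTermAlg.V₁) : L.src (L.kerVal f) = 0 := LinearMap.mem_ker.1 f.2

/-- The additive form of functoriality of `(x, f) ↦ 1ₓ + f`: the identity carried by the second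
arrow is the one subtracted in the composition law. -/
theorem counit_comp (p q : L.C₀ × L.toTermAlg.V₁) (h : p.1 + L.tgt (L.kerVal p.2) = q.1) :
    L.one p.1 + L.kerVal (p.2 + q.2) =
      L.one p.1 + L.kerVal p.2 + (L.one q.1 + L.kerVal q.2)
        - L.one (L.tgt (L.one p.1 + L.kerVal p.2)) := by
  rw [map_add, map_add, L.tgt_one, h]
  abel

/-- The linear functor `(x, f) ↦ 1ₓ + f`. -/
def counitFunctor : L.toTermAlg.toTwoAlg.toTwoVect.LinFunctor L.toTwoVect where
  obj := LinearMap.id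
  map := LinearMap.coprod L.one L.kerVal
  src_map p := (map_add L.src _ _).trans
    ((congrArg₂ (· + ·) (L.src_one p.1) (L.src_kerVal p.2)).trans (add_zero _))
  tgt_map p := (map_add L.tgt _ _).trans (congrArg (· + L.tgt (L.kerVal p.2)) (L.tgt_one p.1))
  map_one _ := add_zero _
  map_comp p q h := (L.counit_comp p q h).trans (TwoVect.comp_eq _ _ _ _).symm

/-- The linear functor `f ↦ (src f, f - 1)`. -/
def counitInvFunctor : L.toTwoVect.LinFunctor L.toTermAlg.toTwoAlg.toTwoVect where
  obj := LinearMap.id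
  map := LinearMap.prod L.src ((LinearMap.id - L.one ∘ₗ L.src).codRestrict (LinearMap.ker L.src)
    fun f => by
      rw [LinearMap.mem_ker, LinearMap.sub_apply, map_sub, LinearMap.comp_apply, L.src_one]
      exact sub_self _)
  src_map _ := rfl
  tgt_map f := by
    change L.src f + L.tgt (f - L.one (L.src f)) = L.tgt f
    rw [map_sub, L.tgt_one, add_sub_cancel]
  map_one x := Prod.ext (L.src_one x) (Subtype.ext (by
    change L.one x - L.one (L.src (L.one x)) = 0
    rw [L.src_one, sub_self]))
  map_comp f g h := Prod.ext (L.src_comp f g h) (Subtype.ext (by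
    change L.comp f g h - L.one (L.src (L.comp f g h)) =
      (f - L.one (L.src f)) + (g - L.one (L.src g))
    rw [L.src_comp, TwoVect.comp_eq, h]; abel))

theorem counitFunctor_counitInvFunctor (f : L.C₁) :
    L.counitFunctor.map (L.counitInvFunctor.map f) = f := add_sub_cancel (L.one (L.src f)) f

theorem counitInvFunctor_counitFunctor (p : L.toTermAlg.toTwoAlg.C₁) :
    L.counitInvFunctor.map (L.counitFunctor.map p) = p := by
  have h := L.counitFunctor.src_map p
  refine Prod.ext h (Subtype.ext ?_)
  change L.counitFunctor.map p - L.one (L.src (L.counitFunctor.map p)) = L.kerVal p.2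
  rw [h]
  exact add_sub_cancel_left (L.one p.1) _

/-- The bracket of arrows rebuilt from the kernel is defined by the very expression that
`br_add_ker` finds for the original bracket. -/
theorem counitFunctor_br (p q r : L.toTermAlg.toTwoAlg.C₁) :
    L.counitFunctor.map (L.toTermAlg.toTwoAlg.br.map p q r) =
      L.br.map (L.counitFunctor.map p) (L.counitFunctor.map q) (L.counitFunctor.map r) :=
  (br_add_ker p.1 q.1 r.1 p.2 q.2 r.2).symm

theorem counitFunctor_J (a b c d e : L.C₀) :
    L.counitFunctor.map (L.toTermAlg.toTwoAlg.J a b c d e) = L.J a b c d e :=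
  add_sub_cancel (L.one (L.br.obj a b (L.br.obj c d e))) _

/-- The component of the counit at `L`. -/
def counitHom : Hom L.toTermAlg.toTwoAlg L :=
  Hom.ofStrict L.counitFunctor (fun _ _ _ => rfl) L.counitFunctor_br L.counitFunctor_J

/-- The inverse of the component of the counit at `L`. -/
def counitInv : Hom L L.toTermAlg.toTwoAlg :=
  Hom.ofStrict L.counitInvFunctor (fun _ _ _ => rfl)
    (fun f g h => by
      -- The inverse of a bracket-preserving bijection preserves brackets.
      rw [← L.counitInvFunctor_counitFunctor (L.toTermAlg.toTwoAlg.br.map _ _ _),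
        L.counitFunctor_br]
      simp only [counitFunctor_counitInvFunctor])
    (fun a b c d e => by
      rw [← L.counitInvFunctor_counitFunctor (L.toTermAlg.toTwoAlg.J _ _ _ _ _)]
      exact (congrArg L.counitInvFunctor.map (L.counitFunctor_J a b c d e)).symm)

theorem counitHom_comp_counitInv : L.counitHom.comp L.counitInv = Hom.id _ :=
  Hom.ext' rfl (LinearMap.ext L.counitInvFunctor_counitFunctor)
    (funext fun x => funext fun y => funext fun z =>
      (Hom.ofStrict_comp_F₂ L.counitHom L.counitInvFunctor _ _ _ x y z).trans
        (L.counitInvFunctor.map_one (L.br.obj x y z)))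

theorem counitInv_comp_counitHom : L.counitInv.comp L.counitHom = Hom.id _ :=
  Hom.ext' rfl (LinearMap.ext L.counitFunctor_counitInvFunctor)
    (funext fun x => funext fun y => funext fun z =>
      (Hom.ofStrict_comp_F₂ L.counitInv L.counitFunctor _ _ _ x y z).trans
        (L.counitFunctor.map_one (L.br.obj x y z)))

variable {L}

/-- On arrows this is additivity of `F` together with preservation of identities. For the natural
transformations, adding back the identity removed in `kerF₂` restores `F₂`. -/
theorem counitHom_naturality (F : Hom L M) :
    F.toTermAlg.toTwoAlg.comp M.counitHom = L.counitHom.comp F :=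
  Hom.ext' rfl
    (LinearMap.ext fun p =>
      ((map_add F.map (L.one p.1) (L.kerVal p.2)).trans
        (congrArg (· + F.map (L.kerVal p.2)) (F.map_one p.1))).symm)
    (funext fun x => funext fun y => funext fun z => by
      refine (Hom.ofStrict_comp_F₂ F.toTermAlg.toTwoAlg M.counitFunctor _ _ _ x y z).trans ?_
      refine Eq.trans ?_ (compF₂_eq L.counitHom F x y z).symm
      change M.one (M.br.obj (F.obj x) (F.obj y) (F.obj z))
        + (F.F₂ x y z - M.one (M.br.obj (F.obj x) (F.obj y) (F.obj z))) =
        F.F₂ x y z + F.map (L.one (L.br.obj x y z)) - M.one (F.obj (L.br.obj x y z))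
      rw [F.map_one]; abel)

variable (K) in
/-- The counit of the 2-equivalence. -/
def counitIso : TwoNatIso
    (StrictPseudofunctor.comp (toTermAlgFunctor.{w, u} K)
      (TwoTermThreeLieInfAlg.toTwoAlgFunctor.{w, u} K))
    (StrictPseudofunctor.id (ThreeLieTwoAlg.{w, u} K)) where
  hom := counitHom
  inv := counitInv
  hom_inv := counitHom_comp_counitInv
  inv_hom := counitInv_comp_counitHom
  naturality := counitHom_naturality
  naturality₂ {_ M F _} σ := comp_eqToHom_eq _ _ _ _ fun x =>
    add_sub_cancel (M.one (F.obj x)) (TwoHom.θ σ x)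

end ThreeLieTwoAlg

end HigherLie

theorem mainTheorem2 (K : Type w) [Field K] :
    Nonempty (HigherLie.TwoEquivalence
      (HigherLie.TwoTermThreeLieInfAlg.{w, u} K) (HigherLie.ThreeLieTwoAlg.{w, u} K)) :=
  ⟨{ functor := HigherLie.TwoTermThreeLieInfAlg.toTwoAlgFunctor K
     inverse := HigherLie.ThreeLieTwoAlg.toTermAlgFunctor K
     unitIso := HigherLie.TwoTermThreeLieInfAlg.unitIso K
     counitIso := HigherLie.ThreeLieTwoAlg.counitIso K }⟩
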